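/- Let $G$ be a locally compact group with left Haar measure, let $1<p<\infty$, and let $L^p(G)$ be the corresponding space of complex-valued functions. For $t\in G$ and $f\in L^p(G)$ put $(\delta_t*f)(s)=f(t^{-1}s)$, and let $$CV_p(G)=\{T\in B(L^p(G)) : T(\delta_t*f)=\delta_t*T(f)\ \text{ for all } t\in G,\ f\in L^p(G)\}$$ be the algebra of convolution operators on $L^p(G)$. For a Banach space $X$, a linear subspace $\mathcal S\subseteq B(X)$ and $T\in B(X)$ put $$\operatorname{dist}(T,\mathcal S)=\inf_{S\in\mathcal S}\|T-S\|,\qquad \operatorname{dist}_r(T,\mathcal S)=\sup_{\|x\|\le 1}\ \inf_{S\in\mathcal S}\|Tx-Sx\|.$$ The space $\mathcal S$ is called reflexive if it contains every $T\in B(X)$ such that $Tx\in\overline{\{Sx : S\in\mathcal S\}}$ for all $x\in X$. It is called hyperreflexive if there is a constant $C\ge 0$ with $\operatorname{dist}(T,\mathcal S)\le C\operatorname{dist}_r(T,\mathcal S)$ for all $T\in B(X)$; the infimum of all such $C$ is its hyperreflexivity constant. Then $CV_p(G)\subseteq B(L^p(G))$ is reflexive. If, in addition, $G$ is amenable (that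 is, there is a left invariant mean on the space of bounded continuous functions on $G$), then $CV_p(G)$ is hyperreflexive and its hyperreflexivity constant is at most $288\pi(1+\sqrt2)$. -/

import Mathlib

open MeasureTheory BoundedContinuousFunction
open scoped ENNReal

noncomputable section

/-- A topological group is amenable if there is a left invariant mean on the space of bounded
continuous complex functions on it, i.e. a linear functional `m` with `‖m‖ = m 1 = 1` and
`m (s ↦ f (t * s)) = m f`. -/
def IsAmenableGroup (G : Type*) [Group G] [TopologicalSpace G] [IsTopologicalGroup G] : Prop :=
  ∃ m : (G →ᵇ ℂ) →L[ℂ] ℂ, ‖m‖ = 1 ∧ m 1 = 1 ∧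
    ∀ (t : G) (f : G →ᵇ ℂ), m (f.compContinuous (ContinuousMap.mulLeft t)) = m f

section Reflexivity

variable {X : Type*} [NormedAddCommGroup X] [NormedSpace ℂ X]

/-- The orbit `{S x | S ∈ 𝒮}` of a vector under a space of operators. -/
def opOrbit (𝒮 : Submodule ℂ (X →L[ℂ] X)) (x : X) : Set X :=
  (fun S : X →L[ℂ] X => S x) '' (𝒮 : Set (X →L[ℂ] X))

/-- A space of operators is reflexive if it contains every bounded operator `T` such that
`T x` lies in the norm closure of `{S x | S ∈ 𝒮}` for every vector `x`. -/
def IsReflexiveOpSpace (𝒮 : Submodule ℂ (X →L[ℂ] X)) : Prop :=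
  ∀ T : X →L[ℂ] X, (∀ x : X, T x ∈ closure (opOrbit 𝒮 x)) → T ∈ 𝒮

/-- `dist_r(T, 𝒮) = sup_{‖x‖ ≤ 1} inf_{S ∈ 𝒮} ‖T x - S x‖`; the supremum is over a nonempty set
bounded by `‖T‖`. -/
def reflexiveDist (𝒮 : Submodule ℂ (X →L[ℂ] X)) (T : X →L[ℂ] X) : ℝ :=
  ⨆ x : Metric.closedBall (0 : X) 1, Metric.infDist (T x) (opOrbit 𝒮 x)

/-- The constants `C ≥ 0` with `dist(T, 𝒮) ≤ C * dist_r(T, 𝒮)` for all bounded operators `T`. -/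
def hyperreflexivityBounds (𝒮 : Submodule ℂ (X →L[ℂ] X)) : Set ℝ :=
  {C | 0 ≤ C ∧ ∀ T : X →L[ℂ] X,
    Metric.infDist T (𝒮 : Set (X →L[ℂ] X)) ≤ C * reflexiveDist 𝒮 T}

/-- A space of operators is hyperreflexive if its distance is controlled by `dist_r`. -/
def IsHyperreflexive (𝒮 : Submodule ℂ (X →L[ℂ] X)) : Prop :=
  (hyperreflexivityBounds 𝒮).Nonempty

/-- The hyperreflexivity constant of a hyperreflexive space of operators. -/
def hyperreflexivityConst (𝒮 : Submodule ℂ (X →L[ℂ] X)) : ℝ :=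
  sInf (hyperreflexivityBounds 𝒮)

end Reflexivity

section Convolution

variable {G : Type*} [Group G] [TopologicalSpace G] [IsTopologicalGroup G]
  [MeasurableSpace G] [BorelSpace G]

/-- Left translation `f ↦ δ_t * f` on `L^p(G)`, where `(δ_t * f)(s) = f (t⁻¹ * s)`. -/
def leftTranslation (μ : Measure G) [μ.IsMulLeftInvariant] (p : ℝ≥0∞) [Fact (1 ≤ p)] (t : G) :
    Lp ℂ p μ →L[ℂ] Lp ℂ p μ :=
  (Lp.compMeasurePreservingₗᵢ ℂ (fun s : G => t⁻¹ * s)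
    (measurePreserving_mul_left μ t⁻¹)).toContinuousLinearMap

/-- The algebra `CV_p(G)` of bounded operators on `L^p(G)` commuting with all left
translations. -/
def convolutionOperators (μ : Measure G) [μ.IsMulLeftInvariant] (p : ℝ≥0∞) [Fact (1 ≤ p)] :
    Subalgebra ℂ (Lp ℂ p μ →L[ℂ] Lp ℂ p μ) where
  carrier := {T | ∀ (t : G) (f : Lp ℂ p μ),
    T (leftTranslation μ p t f) = leftTranslation μ p t (T f)}
  mul_mem' := by
    intro S T hS hT t f
    simp only [mul_apply_eq_comp, hT t f, hS t (T f)]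
  add_mem' := by
    intro S T hS hT t f
    simp only [_root_.add_apply, hS t f, hT t f, map_add]
  algebraMap_mem' := by
    intro c t f
    simp only [Algebra.algebraMap_eq_smul_one, _root_.smul_apply,
      one_apply_eq_self, map_smul]

end Convolution

end

/-!
Let `ρ` be a contractive representation of `G` with commutant `𝒮`, and let `T` be an operator with
`dist (T x) (𝒮 x) ≤ ε * ‖x‖` for all `x`. The point is to bound `κ = sup ‖ρ t * T * ρ t⁻¹ - T‖` by a
multiple of `ε`. Fix `t` and cover the circle by `N` tents of half width `1 / N`. Their Fourier
series converge absolutely, so they can be evaluated at `n ↦ ρ (t ^ n)`, which gives operators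
`e j` in the commutant of `𝒮`. Tents that are not adjacent have product zero, so
`e j * S * e k = 0` for `S ∈ 𝒮` and hence `‖e j * T * e k‖ ≤ ε`. The discrete Fourier transform of
the `e j` consists of the Fejér averages of `ρ (t ^ n)` over the residue classes of `n` modulo `N`.
Through it, the bounds on `e j * T * e k` show that `T` almost commutes with the averages over the
classes of `1` and `-1`, up to `2 * N ^ 2 * ε + 4 * π / N * κ`, and these averages are
`O(1 / N ^ 2)`-close to `ρ t` and `ρ t⁻¹`. For `N = 20` the resulting inequality `κ ≤ C * ε + q * κ`
has `q < 1`.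

Reflexivity is the case `ε = 0`. If `G` is amenable, the mean of the operators `ρ t * T * ρ t⁻¹` in
the weak operator topology exists since `L^p` is uniformly convex, hence reflexive; it lies in `𝒮`,
at distance at most `κ` from `T`.
-/

noncomputable section

section FejerWeight

open scoped Real

/-- The weights `sinc (π n / N) ^ 2`: up to the factor `N`, the Fourier coefficients of the tent
function of half width `1 / N` on the circle. -/
def fejerWeight (N : ℕ) (n : ℤ) : ℝ := Real.sinc (π * n / N) ^ 2

lemma fejerWeight_nonneg (N : ℕ) (n : ℤ) : 0 ≤ fejerWeight N n := sq_nonneg _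

@[simp] lemma fejerWeight_zero (N : ℕ) : fejerWeight N 0 = 1 := by simp [fejerWeight]

@[simp] lemma fejerWeight_neg (N : ℕ) (n : ℤ) : fejerWeight N (-n) = fejerWeight N n := by
  rw [fejerWeight, fejerWeight, Int.cast_neg, mul_neg, neg_div, Real.sinc_neg]

lemma fourier_coe_add_fourier_coe_neg (n : ℤ) (t : ℝ) :
    fourier n (t : UnitAddCircle) + fourier n (-t : UnitAddCircle) =
      2 - 4 * Complex.sin (π * n * t) ^ 2 := by
  rw [← AddCircle.coe_neg, fourier_coe_apply, fourier_coe_apply,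
    show 2 * (π : ℂ) * Complex.I * n * t / (1 : ℝ) = 2 * (π * n * t) * Complex.I by
      push_cast; ring,
    show 2 * (π : ℂ) * Complex.I * n * (-t : ℝ) / (1 : ℝ) = -(2 * (π * n * t)) * Complex.I by
      push_cast; ring,
    ← Complex.two_cos, Complex.cos_two_mul, Complex.cos_sq']
  ring

variable (N : ℕ) [NeZero N]

lemma fejerWeight_eq_sin_sq_div {n : ℤ} (hn : n ≠ 0) :
    fejerWeight N n = Real.sin (π * n / N) ^ 2 / (π * n / N) ^ 2 := by
  have hx : π * n / N ≠ 0 :=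
    div_ne_zero (mul_ne_zero Real.pi_ne_zero (Int.cast_ne_zero.mpr hn)) (NeZero.ne _)
  rw [fejerWeight, Real.sinc_of_ne_zero hx, div_pow]

lemma one_sub_fejerWeight_one_le : 1 - fejerWeight N 1 ≤ (π / N) ^ 2 / 3 := by
  have hN : (0 : ℝ) < N := Nat.cast_pos.mpr (NeZero.pos N)
  set x := π / N
  have hx : 0 < x := by positivity
  have hw : fejerWeight N 1 = (Real.sin x / x) ^ 2 := by
    simp [fejerWeight_eq_sin_sq_div N one_ne_zero, x, div_pow]
  have hsin : 1 - x ^ 2 / 6 ≤ Real.sin x / x := by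
    rw [le_div_iff₀ hx]
    linarith [Real.sin_gt_sub_cube hx]
  nlinarith [sq_nonneg (Real.sin x / x - 1)]

-- The tent is a second difference of the Bernoulli function `B₂`, whose coefficients are `∝ n⁻²`.
lemma fejerWeight_mul_fourier (n : ℤ) (x : UnitAddCircle) :
    (fejerWeight N n : ℂ) * fourier n x =
      (if n = 0 then 1 else 0) + (N : ℂ) ^ 2 / (2 * π ^ 2) *
        (1 / (n : ℂ) ^ 2 * fourier n x -
          (1 / (n : ℂ) ^ 2 * fourier n (x + ((1 / N : ℝ) : UnitAddCircle)) +
            1 / (n : ℂ) ^ 2 * fourier n (x - ((1 / N : ℝ) : UnitAddCircle))) / 2) := by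
  rcases eq_or_ne n 0 with rfl | hn
  · simp
  have hn' : (n : ℂ) ≠ 0 := Int.cast_ne_zero.mpr hn
  have hπ : (π : ℂ) ≠ 0 := Complex.ofReal_ne_zero.mpr Real.pi_ne_zero
  have hadd (y z : UnitAddCircle) : fourier n (y + z) = fourier n y * fourier n z := by
    simp only [fourier_apply, smul_add, AddCircle.toCircle_add, Circle.coe_mul]
  have hsum := fourier_coe_add_fourier_coe_neg n (1 / N)
  rw [← mul_add, sub_eq_add_neg x, hadd, hadd, ← mul_add, hsum, fejerWeight_eq_sin_sq_div N hn,
    if_neg hn]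
  push_cast
  field_simp
  ring

lemma hasSum_fejerWeight_mul_fourier {x y z : ℝ} (hx : x ∈ Set.Icc (0 : ℝ) 1)
    (hy : y ∈ Set.Icc (0 : ℝ) 1) (hz : z ∈ Set.Icc (0 : ℝ) 1)
    (hxy : (y : UnitAddCircle) = x + ((1 / N : ℝ) : UnitAddCircle))
    (hxz : (z : UnitAddCircle) = x - ((1 / N : ℝ) : UnitAddCircle)) :
    HasSum (fun n : ℤ => (fejerWeight N n : ℂ) * fourier n (x : UnitAddCircle))
      (1 + N ^ 2 * (bernoulliFun 2 x - (bernoulliFun 2 y + bernoulliFun 2 z) / 2)) := by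
  simp_rw [fejerWeight_mul_fourier, ← hxy, ← hxz]
  have hB {t : ℝ} (ht : t ∈ Set.Icc (0 : ℝ) 1) :=
    hasSum_one_div_pow_mul_fourier_mul_bernoulliFun le_rfl ht
  have hdiff := (hB hx).sub (((hB hy).add (hB hz)).div_const 2)
  convert (hasSum_ite_eq (0 : ℤ) (1 : ℂ)).add
    (hdiff.mul_left ((N : ℂ) ^ 2 / (2 * π ^ 2))) using 1
  have hπ : (π : ℂ) ≠ 0 := Complex.ofReal_ne_zero.mpr Real.pi_ne_zero
  have hsq : (2 * (π : ℂ) * Complex.I) ^ 2 = -(4 * π ^ 2) := by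
    rw [mul_pow, Complex.I_sq]; ring
  rw [hsq, Nat.factorial_two]
  field_simp
  push_cast
  ring

lemma hasSum_fejerWeight_mul_fourier_of_le_norm {x : UnitAddCircle} (hx : 1 / N ≤ ‖x‖) :
    HasSum (fun n : ℤ => (fejerWeight N n : ℂ) * fourier n x) 0 := by
  have hN : (0 : ℝ) < 1 / N := by have := NeZero.pos N; positivity
  obtain ⟨t, ht, rfl⟩ := AddCircle.eq_coe_Ico x
  rw [UnitAddCircle.norm_eq, abs_sub_round_eq_min, Int.fract_eq_self.mpr ht, le_min_iff] at hx
  convert hasSum_fejerWeight_mul_fourier N (x := t) (y := t + 1 / N) (z := t - 1 / N)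
    ⟨by linarith, by linarith⟩ ⟨by linarith, by linarith⟩ ⟨by linarith, by linarith⟩
    (AddCircle.coe_add _ _ _) (AddCircle.coe_sub _ _ _) using 1
  have hN' : (N : ℂ) ≠ 0 := NeZero.ne _
  simp only [bernoulliFun_two]
  push_cast
  field_simp
  ring

lemma hasSum_fejerWeight : HasSum (fejerWeight N) N := by
  have hN : (0 : ℝ) < 1 / N := by have := NeZero.pos N; positivity
  have hN1 : 1 / (N : ℝ) ≤ 1 := by simpa using Nat.cast_inv_le_one N
  have h := hasSum_fejerWeight_mul_fourier N (x := 0) (y := 1 / N) (z := 1 - 1 / N)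
    ⟨by linarith, by linarith⟩ ⟨by linarith, by linarith⟩ ⟨by linarith, by linarith⟩
    (by simp) (by rw [AddCircle.coe_sub, AddCircle.coe_period]; simp)
  simp only [AddCircle.coe_zero, fourier_eval_zero, mul_one] at h
  rw [← Complex.hasSum_ofReal]
  convert h using 1
  have hN' : (N : ℂ) ≠ 0 := NeZero.ne _
  simp only [bernoulliFun_two]
  push_cast
  field_simp
  ring

end FejerWeight

section WienerAlgebra

section NormedSpace

variable {ι E F : Type*} [NormedAddCommGroup E] [NormedSpace ℂ E] [NormedAddCommGroup F]
  [NormedSpace ℂ F] {u : ι → E} {a b : ι → ℂ} {C : ℝ}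

/-- Evaluation at a bounded family `u` of a function `a` with `∑ |a n| < ∞`, thought of as the
coefficients of an absolutely convergent Fourier series; it is `0` if `a n • u n` is not
summable. -/
def wienerEval (u : ι → E) (a : ι → ℂ) : E := ∑' n, a n • u n

lemma summable_norm_smul (hu : ∀ n, ‖u n‖ ≤ C) (ha : Summable fun n => ‖a n‖) :
    Summable fun n => ‖a n • u n‖ :=
  (ha.mul_right C).of_nonneg_of_le (fun _ => norm_nonneg _) fun n => by
    rw [norm_smul]; gcongr; exact hu n

lemma hasSum_wienerEval [CompleteSpace E] (hu : ∀ n, ‖u n‖ ≤ C) (ha : Summable fun n => ‖a n‖) :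
    HasSum (fun n => a n • u n) (wienerEval u a) :=
  (summable_norm_smul hu ha).of_norm.hasSum

lemma norm_wienerEval_le (hu : ∀ n, ‖u n‖ ≤ C) (ha : Summable fun n => ‖a n‖) :
    ‖wienerEval u a‖ ≤ (∑' n, ‖a n‖) * C :=
  tsum_of_norm_bounded (ha.hasSum.mul_right C) fun n => by
    rw [norm_smul]; gcongr; exact hu n

lemma wienerEval_single [DecidableEq ι] (u : ι → E) (k : ι) :
    wienerEval u (Pi.single k 1) = u k := by
  rw [wienerEval, tsum_eq_single k fun n hn => by simp [hn]]
  simp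

variable [CompleteSpace E]

lemma wienerEval_sub (hu : ∀ n, ‖u n‖ ≤ C) (ha : Summable fun n => ‖a n‖)
    (hb : Summable fun n => ‖b n‖) :
    wienerEval u (a - b) = wienerEval u a - wienerEval u b := by
  simp only [wienerEval, Pi.sub_apply, sub_smul]
  exact ((hasSum_wienerEval hu ha).sub (hasSum_wienerEval hu hb)).tsum_eq

lemma map_wienerEval (L : E →L[ℂ] F) (hu : ∀ n, ‖u n‖ ≤ C) (ha : Summable fun n => ‖a n‖) :
    L (wienerEval u a) = wienerEval (fun n => L (u n)) a := by
  simp only [wienerEval, ← map_smul]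
  exact ((hasSum_wienerEval hu ha).mapL L).tsum_eq.symm

open scoped ZMod in
lemma invDFT_wienerEval {N : ℕ} [NeZero N] {c : ZMod N → ι → ℂ} (hu : ∀ n, ‖u n‖ ≤ C)
    (hc : ∀ r, Summable fun n => ‖c r n‖) (j : ZMod N) :
    𝓕⁻ (fun r => wienerEval u (c r)) j = wienerEval u (𝓕⁻ c j) := by
  simp only [ZMod.invDFT_apply]
  refine HasSum.tsum_eq ?_ |>.symm
  convert (hasSum_sum fun r (_ : r ∈ Finset.univ) =>
    (hasSum_wienerEval hu (hc r)).const_smul (ZMod.stdAddChar (r * j))).const_smul (N : ℂ)⁻¹ using 2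
  simp only [Pi.smul_apply, Finset.sum_apply, smul_assoc, Finset.sum_smul]

end NormedSpace

section NormedRing

variable {A : Type*} [NormedRing A] [NormedAlgebra ℂ A]

lemma commute_wienerEval {ι : Type*} {u : ι → A} {C : ℝ} {a : ι → ℂ} {S : A}
    [CompleteSpace A] (hu : ∀ n, ‖u n‖ ≤ C)
    (hS : ∀ n, Commute S (u n)) (ha : Summable fun n => ‖a n‖) : Commute S (wienerEval u a) := by
  refine ((hasSum_wienerEval hu ha).mul_left S).unique ?_
  simpa only [smul_mul_assoc, mul_smul_comm, (hS _).eq] using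
    (hasSum_wienerEval hu ha).mul_right S

variable {ι : Type*} [AddCommGroup ι] {C : ℝ} {a b : ι → ℂ}

lemma summable_norm_mul_sub (ha : Summable fun n => ‖a n‖) (hb : Summable fun n => ‖b n‖) :
    Summable fun q : ι × ι => ‖a q.2 * b (q.1 - q.2)‖ :=
  ((Equiv.prodComm ι ι).trans (Equiv.prodShear (Equiv.refl ι) Equiv.subRight)).summable_iff.mpr
    (summable_mul_of_summable_norm ha hb).norm

lemma summable_norm_tsum_mul_sub (ha : Summable fun n => ‖a n‖) (hb : Summable fun n => ‖b n‖) :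
    Summable fun k => ‖∑' m, a m * b (k - m)‖ :=
  (summable_norm_mul_sub ha hb).prod.of_nonneg_of_le (fun _ => norm_nonneg _) fun k =>
    norm_tsum_le_tsum_norm ((summable_norm_mul_sub ha hb).prod_factor k)

lemma wienerEval_mul_wienerEval [CompleteSpace A] (u : AddChar ι A) (hu : ∀ n, ‖u n‖ ≤ C)
    (ha : Summable fun n => ‖a n‖) (hb : Summable fun n => ‖b n‖) :
    wienerEval u a * wienerEval u b = wienerEval u fun k => ∑' m, a m * b (k - m) := by
  let e : ι × ι ≃ ι × ι :=
    (Equiv.prodComm ι ι).trans (Equiv.prodShear (Equiv.refl ι) Equiv.subRight)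
  have hterm (q : ι × ι) : (a (e q).1 • u (e q).1) * (b (e q).2 • u (e q).2) =
      (a q.2 * b (q.1 - q.2)) • u q.1 := by
    rw [smul_mul_smul_comm, ← AddChar.map_add_eq_mul]
    simp [e]
  have hab := summable_norm_mul_sub ha hb
  have hsum : Summable fun q : ι × ι => (a q.2 * b (q.1 - q.2)) • u q.1 :=
    (summable_norm_smul (u := fun q : ι × ι => u q.1) (fun q => hu q.1) hab).of_norm
  calc wienerEval u a * wienerEval u b
      = ∑' q : ι × ι, (a (e q).1 • u (e q).1) * (b (e q).2 • u (e q).2) := by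
        rw [e.tsum_eq fun q => (a q.1 • u q.1) * (b q.2 • u q.2)]
        exact tsum_mul_tsum_of_summable_norm (summable_norm_smul hu ha) (summable_norm_smul hu hb)
    _ = ∑' k, ∑' m, (a m * b (k - m)) • u k := by simp only [hterm, hsum.tsum_prod]
    _ = wienerEval u fun k => ∑' m, a m * b (k - m) :=
        tsum_congr fun k => (hab.prod_factor k).of_norm.tsum_smul_const _

/-- The character `n ↦ fourier n` of `ℤ` in the algebra of continuous functions on the circle;
evaluation at it is summation of the Fourier series. -/
def fourierAddChar : AddChar ℤ C(UnitAddCircle, ℂ) where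
  toFun := fourier
  map_zero_eq_one' := by ext; simp
  map_add_eq_mul' _ _ := by ext; simp

lemma norm_fourierAddChar_le (n : ℤ) : ‖fourierAddChar n‖ ≤ 1 := (fourier_norm n).le

lemma wienerEval_fourierAddChar_apply {a : ℤ → ℂ} (ha : Summable fun n => ‖a n‖)
    (x : UnitAddCircle) : wienerEval (⇑fourierAddChar) a x = ∑' n, a n * fourier n x :=
  map_wienerEval (ContinuousMap.evalCLM ℂ x) norm_fourierAddChar_le ha

lemma fourierCoeff_wienerEval_fourierAddChar {a : ℤ → ℂ} (ha : Summable fun n => ‖a n‖) (k : ℤ) :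
    fourierCoeff (wienerEval (⇑fourierAddChar) a : C(UnitAddCircle, ℂ)) k = a k := by
  let L : C(UnitAddCircle, ℂ) →L[ℂ] ℂ := innerSL ℂ (fourierLp 2 k) ∘L
    ContinuousMap.toLp 2 AddCircle.haarAddCircle ℂ
  have hL (f : C(UnitAddCircle, ℂ)) : L f = fourierCoeff f k := by
    rw [← fourierCoeff_toLp, ← fourierBasis_repr, HilbertBasis.repr_apply_apply, coe_fourierBasis]
    rfl
  have hcoeff (n : ℤ) : L (fourierAddChar n) = if n = k then 1 else 0 := by
    rw [hL, show (fourierAddChar n : UnitAddCircle → ℂ) = fourier n from rfl, fourierCoeff_fourier,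
      Pi.single_apply]
    simp only [eq_comm]
  rw [← hL, map_wienerEval L norm_fourierAddChar_le ha, wienerEval]
  simp [hcoeff]

lemma wienerEval_mul_wienerEval_eq_zero [CompleteSpace A] {a b : ℤ → ℂ} (u : AddChar ℤ A)
    (hu : ∀ n, ‖u n‖ ≤ C) (ha : Summable fun n => ‖a n‖) (hb : Summable fun n => ‖b n‖)
    (h : wienerEval fourierAddChar a * wienerEval fourierAddChar b = 0) :
    wienerEval u a * wienerEval u b = 0 := by
  have hzero : (fun k => ∑' m, a m * b (k - m)) = 0 := by
    rw [wienerEval_mul_wienerEval _ norm_fourierAddChar_le ha hb] at h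
    ext k
    rw [← fourierCoeff_wienerEval_fourierAddChar (summable_norm_tsum_mul_sub ha hb) k, h]
    simp [fourierCoeff]
  rw [wienerEval_mul_wienerEval u hu ha hb, hzero]
  simp [wienerEval]

end NormedRing

end WienerAlgebra

section ResidueWeight

lemma eq_of_abs_valMinAbs_le_one {N : ℕ} {d : ZMod N} (hd : |d.valMinAbs| ≤ 1) :
    d = 0 ∨ d = 1 ∨ d = -1 := by
  rw [← ZMod.coe_valMinAbs d]
  obtain h | h | h : d.valMinAbs = 0 ∨ d.valMinAbs = 1 ∨ d.valMinAbs = -1 := by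
    rw [abs_le] at hd; omega
  all_goals simp [h]

variable (N : ℕ) [NeZero N]

lemma norm_toAddCircle (j : ZMod N) : ‖ZMod.toAddCircle j‖ = |(j.valMinAbs : ℝ)| / N := by
  have hN : (0 : ℝ) < N := Nat.cast_pos.mpr (NeZero.pos N)
  have hle : 2 * |(j.valMinAbs : ℝ)| ≤ N := by
    have h := ZMod.natAbs_valMinAbs_le j
    rw [← Int.cast_abs, Int.abs_eq_natAbs]
    exact_mod_cast (by omega : 2 * j.valMinAbs.natAbs ≤ N)
  have habs : |(j.valMinAbs / N : ℝ)| = |(j.valMinAbs : ℝ)| / N := by rw [abs_div, Nat.abs_cast]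
  nth_rw 1 [← ZMod.coe_valMinAbs j]
  rw [ZMod.toAddCircle_intCast, ← habs, AddCircle.norm_coe_eq_abs_iff 1 one_ne_zero, habs,
    div_le_iff₀ hN]
  norm_num
  linarith

lemma stdAddChar_intCast_mul (n : ℤ) (j : ZMod N) :
    ZMod.stdAddChar ((n : ZMod N) * j) = fourier n (ZMod.toAddCircle j) := by
  rw [fourier_apply, ← map_zsmul, zsmul_eq_mul]
  rfl

/-- The Fejér weights restricted to the residue class `r` modulo `N`. -/
def residueWeight (r : ZMod N) (n : ℤ) : ℂ := if (n : ZMod N) = r then fejerWeight N n else 0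

/-- The Fourier coefficients of the tent of height `1` and half width `1 / N` centred at `-j / N`.
These tents form a partition of unity. -/
def tentCoeff (j : ZMod N) (n : ℤ) : ℂ :=
  (N : ℂ)⁻¹ * (ZMod.stdAddChar ((n : ZMod N) * j) * fejerWeight N n)

open scoped ZMod in
lemma invDFT_residueWeight : 𝓕⁻ (residueWeight N) = tentCoeff N := by
  ext j n
  simp [ZMod.invDFT_apply, residueWeight, tentCoeff]

lemma summable_norm_residueWeight (r : ZMod N) : Summable fun n => ‖residueWeight N r n‖ :=
  (hasSum_fejerWeight N).summable.of_nonneg_of_le (fun _ => norm_nonneg _) fun n => by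
    have := fejerWeight_nonneg N n
    unfold residueWeight
    split_ifs <;> simp [abs_of_nonneg, this]

lemma hasSum_norm_tentCoeff (j : ZMod N) : HasSum (fun n => ‖tentCoeff N j n‖) 1 := by
  have hN : (N : ℝ) ≠ 0 := NeZero.ne _
  have h := (hasSum_fejerWeight N).mul_left (N : ℝ)⁻¹
  rw [inv_mul_cancel₀ hN] at h
  refine h.congr_fun fun n => ?_
  simp [tentCoeff, abs_of_nonneg (fejerWeight_nonneg N n)]

lemma wienerEval_fourierAddChar_tentCoeff_apply (j : ZMod N) (x : UnitAddCircle) :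
    (wienerEval fourierAddChar (tentCoeff N j) : C(UnitAddCircle, ℂ)) x =
      (N : ℂ)⁻¹ * ∑' n : ℤ, fejerWeight N n * fourier n (x + ZMod.toAddCircle j) := by
  rw [wienerEval_fourierAddChar_apply (hasSum_norm_tentCoeff N j).summable, ← tsum_mul_left]
  refine tsum_congr fun n => ?_
  rw [tentCoeff, stdAddChar_intCast_mul]
  simp only [fourier_apply, smul_add, AddCircle.toCircle_add, Circle.coe_mul]
  ring

lemma wienerEval_fourierAddChar_tentCoeff_apply_eq_zero {j : ZMod N} {x : UnitAddCircle}
    (hx : 1 / N ≤ ‖x + ZMod.toAddCircle j‖) :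
    (wienerEval fourierAddChar (tentCoeff N j) : C(UnitAddCircle, ℂ)) x = 0 := by
  rw [wienerEval_fourierAddChar_tentCoeff_apply,
    (hasSum_fejerWeight_mul_fourier_of_le_norm N hx).tsum_eq, mul_zero]

lemma wienerEval_fourierAddChar_tentCoeff_apply_zero (j : ZMod N) :
    (wienerEval fourierAddChar (tentCoeff N j) : C(UnitAddCircle, ℂ)) 0 =
      (Pi.single 0 1 : ZMod N → ℂ) j := by
  rcases eq_or_ne j 0 with rfl | hj
  · have hN : (N : ℂ) ≠ 0 := NeZero.ne _
    rw [wienerEval_fourierAddChar_tentCoeff_apply]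
    simp only [map_zero, add_zero, fourier_eval_zero, mul_one]
    rw [(Complex.hasSum_ofReal.mpr (hasSum_fejerWeight N)).tsum_eq]
    simp [hN]
  · rw [Pi.single_eq_of_ne hj]
    apply wienerEval_fourierAddChar_tentCoeff_apply_eq_zero
    rw [zero_add, norm_toAddCircle]
    gcongr
    exact_mod_cast Int.one_le_abs ((ZMod.valMinAbs_eq_zero j).not.mpr hj)

lemma wienerEval_fourierAddChar_tentCoeff_mul_eq_zero {j k : ZMod N}
    (hjk : j - k ∉ ({0, 1, -1} : Finset (ZMod N))) :
    (wienerEval fourierAddChar (tentCoeff N j) : C(UnitAddCircle, ℂ)) *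
      wienerEval fourierAddChar (tentCoeff N k) = 0 := by
  ext x
  rw [ContinuousMap.mul_apply, ContinuousMap.zero_apply, mul_eq_zero]
  by_contra! h
  have hj : ‖x + ZMod.toAddCircle j‖ < 1 / N := by
    contrapose! h; exact fun h' => (h' (wienerEval_fourierAddChar_tentCoeff_apply_eq_zero N h)).elim
  have hk : ‖x + ZMod.toAddCircle k‖ < 1 / N := by
    contrapose! h; exact fun _ => wienerEval_fourierAddChar_tentCoeff_apply_eq_zero N h
  have hlt : |((j - k).valMinAbs : ℝ)| / N < 2 / N := by
    rw [← norm_toAddCircle, map_sub, ← add_sub_add_left_eq_sub _ _ x]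
    refine (norm_sub_le _ _).trans_lt ((add_lt_add hj hk).trans_eq (by ring))
  have hlt' : |(j - k).valMinAbs| < 2 := by
    exact_mod_cast (div_lt_div_iff_of_pos_right (Nat.cast_pos.mpr (NeZero.pos N))).mp hlt
  exact hjk (by simpa using eq_of_abs_valMinAbs_le_one (Int.lt_add_one_iff.mp hlt'))

open scoped ZMod in
lemma hasSum_norm_residueWeight (r : ZMod N) : HasSum (fun n => ‖residueWeight N r n‖) 1 := by
  have hs := summable_norm_residueWeight N
  let F : ZMod N → C(UnitAddCircle, ℂ) := fun r => wienerEval fourierAddChar (residueWeight N r)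
  have hF : 𝓕⁻ (fun r => F r 0) = Pi.single 0 1 := by
    ext j
    rw [← wienerEval_fourierAddChar_tentCoeff_apply_zero, ← invDFT_residueWeight,
      ← invDFT_wienerEval norm_fourierAddChar_le hs]
    simp [ZMod.invDFT_apply, F]
  have hFr : F r 0 = 1 := by
    have h := congrFun (congrArg (𝓕 : (ZMod N → ℂ) → ZMod N → ℂ) hF) r
    rw [LinearEquiv.apply_symm_apply] at h
    simpa [ZMod.dft_apply, Pi.single_apply] using h
  have hnorm (n : ℤ) : ((‖residueWeight N r n‖ : ℝ) : ℂ) = residueWeight N r n := by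
    unfold residueWeight
    split_ifs <;> simp [abs_of_nonneg (fejerWeight_nonneg N n)]
  rw [← Complex.hasSum_ofReal, Complex.ofReal_one, ← hFr, funext hnorm,
    wienerEval_fourierAddChar_apply (hs r)]
  simpa only [fourier_eval_zero, mul_one] using (hs r).of_norm.hasSum

lemma residueWeight_zero : residueWeight N 0 = Pi.single 0 1 := by
  have hN : (N : ℝ) ≠ 0 := NeZero.ne _
  ext n
  rcases eq_or_ne n 0 with rfl | hn
  · simp [residueWeight]
  rw [Pi.single_eq_of_ne hn, residueWeight, ite_eq_right_iff, ZMod.intCast_zmod_eq_zero_iff_dvd]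
  rintro ⟨m, rfl⟩
  have hm : Real.pi * (N * m : ℤ) / N = m * Real.pi := by push_cast; field_simp
  rw [fejerWeight_eq_sin_sq_div N hn, hm, Real.sin_int_mul_pi]
  simp

lemma hasSum_norm_residueWeight_sub_single (k : ℤ) :
    HasSum (fun n => ‖(residueWeight N k - Pi.single k 1 : ℤ → ℂ) n‖)
      (2 * (1 - fejerWeight N k)) := by
  have hle : fejerWeight N k ≤ 1 := by
    rw [fejerWeight, sq_le_one_iff_abs_le_one]
    exact Real.abs_sinc_le_one _
  convert (hasSum_norm_residueWeight N k).add (hasSum_ite_eq k (1 - 2 * fejerWeight N k)) using 1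
  · ext n
    rcases eq_or_ne n k with rfl | hn
    · rw [Pi.sub_apply, Pi.single_eq_same, residueWeight, if_pos rfl, if_pos rfl,
        ← Complex.ofReal_one, ← Complex.ofReal_sub, Complex.norm_real, Complex.norm_real,
        Real.norm_of_nonneg (fejerWeight_nonneg N n), Real.norm_of_nonpos (by linarith)]
      ring
    · simp [hn]
  · ring

end ResidueWeight

section FiniteFourier

open scoped ZMod

variable {N : ℕ}

lemma card_zero_one_neg_one (hN : 3 ≤ N) : ({0, 1, -1} : Finset (ZMod N)).card = 3 := by
  have : Fact (2 < N) := ⟨hN⟩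
  have : Fact (1 < N) := ⟨by omega⟩
  exact Finset.card_eq_three.mpr ⟨0, 1, -1, zero_ne_one, (neg_ne_zero.mpr one_ne_zero).symm,
    ZMod.neg_one_ne_one.symm, rfl⟩

variable [NeZero N]

lemma norm_stdAddChar_intCast_sub_one_le (k : ℤ) :
    ‖(ZMod.stdAddChar (k : ZMod N) : ℂ) - 1‖ ≤ 2 * Real.pi / N * |(k : ℝ)| := by
  rw [ZMod.stdAddChar_coe, show 2 * Real.pi * Complex.I * k / N =
    Complex.I * (2 * Real.pi / N * k : ℝ) by push_cast; ring]
  refine (Real.norm_exp_I_mul_ofReal_sub_one_le).trans_eq ?_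
  rw [norm_mul, Real.norm_of_nonneg (by positivity), Real.norm_eq_abs]

section Module

variable {V W : Type*} [AddCommGroup V] [Module ℂ V] [AddCommGroup W] [Module ℂ W]

/-- The sums of a bilinear map `β` along the cyclic diagonals `{(k + d, k)}`. -/
def cyclicAutocorrelation (β : V →ₗ[ℂ] V →ₗ[ℂ] W) (e : ZMod N → V) (d : ZMod N) : W :=
  ∑ k, β (e (k + d)) (e k)

lemma dft_cyclicAutocorrelation (β : V →ₗ[ℂ] V →ₗ[ℂ] W) (e : ZMod N → V) (r : ZMod N) :
    𝓕 (cyclicAutocorrelation β e) r = β (𝓕 e r) (𝓕 e (-r)) := by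
  simp only [ZMod.dft_apply, cyclicAutocorrelation, map_sum, map_smul, LinearMap.sum_apply,
    LinearMap.smul_apply, Finset.smul_sum, smul_smul]
  rw [Finset.sum_comm]
  refine Finset.sum_congr rfl fun k _ => ?_
  refine Fintype.sum_equiv (Equiv.addLeft k) _ _ fun d => ?_
  rw [Equiv.coe_addLeft, ← AddChar.map_add_eq_mul]
  congr 2
  ring

end Module

variable {V W : Type*} [NormedAddCommGroup V] [NormedSpace ℂ V] [NormedAddCommGroup W]
  [NormedSpace ℂ W] {κ ε : ℝ}

lemma norm_invDFT_le {a : ZMod N → W} (ha : ∀ r, ‖a r‖ ≤ κ) (j : ZMod N) : ‖𝓕⁻ a j‖ ≤ κ := by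
  have hN : (N : ℝ) ≠ 0 := NeZero.ne _
  rw [ZMod.invDFT_apply, norm_smul, norm_inv, Complex.norm_natCast]
  have hsum : ‖∑ r, ZMod.stdAddChar (r * j) • a r‖ ≤ ∑ _r : ZMod N, κ :=
    norm_sum_le_of_le _ fun r _ => by simpa [norm_smul] using ha r
  calc (N : ℝ)⁻¹ * ‖∑ r, ZMod.stdAddChar (r * j) • a r‖ ≤ (N : ℝ)⁻¹ * (N * κ) := by
        gcongr; simpa using hsum
    _ = κ := inv_mul_cancel_left₀ hN κ

lemma norm_dft_one_le {g : ZMod N → W} (hN : 3 ≤ N) (hg₀ : 𝓕 g 0 = 0) (hκ : ∀ d, ‖g d‖ ≤ κ)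
    (hε : ∀ d ∉ ({0, 1, -1} : Finset (ZMod N)), ‖g d‖ ≤ ε) :
    ‖𝓕 g 1‖ ≤ (N - 3) * (2 * ε) + 2 * (2 * Real.pi / N * κ) := by
  have hdft : 𝓕 g 1 = ∑ d, (ZMod.stdAddChar (-d) - 1 : ℂ) • g d := by
    rw [← sub_zero (𝓕 g 1), ← hg₀, ZMod.dft_apply_zero, ZMod.dft_apply]
    simp only [mul_one, sub_smul, one_smul, Finset.sum_sub_distrib]
  have hfar : ‖∑ d ∈ {0, 1, -1}ᶜ, (ZMod.stdAddChar (-d) - 1 : ℂ) • g d‖ ≤ (N - 3) * (2 * ε) := by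
    refine (norm_sum_le_of_le _ (n := fun _ => 2 * ε) fun d hd => ?_).trans_eq ?_
    · rw [norm_smul]
      refine mul_le_mul ?_ (hε d (Finset.mem_compl.mp hd)) (norm_nonneg _) zero_le_two
      exact (norm_sub_le _ _).trans_eq (by rw [AddChar.norm_apply, norm_one]; norm_num)
    · rw [Finset.sum_const, Finset.card_compl, card_zero_one_neg_one hN, ZMod.card, nsmul_eq_mul,
        Nat.cast_sub hN, Nat.cast_ofNat]
  have hnear (s : ℤ) (hs : |s| = 1) :
      ‖(ZMod.stdAddChar (-s : ZMod N) - 1 : ℂ) • g s‖ ≤ 2 * Real.pi / N * κ := by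
    rw [norm_smul]
    refine mul_le_mul ?_ (hκ s) (norm_nonneg _) (by positivity)
    have h := norm_stdAddChar_intCast_sub_one_le (N := N) (-s)
    rwa [← Int.cast_abs, abs_neg, hs, Int.cast_one, mul_one, Int.cast_neg] at h
  rw [hdft, ← Finset.sum_compl_add_sum ({0, 1, -1} : Finset (ZMod N))]
  refine (norm_add_le _ _).trans (add_le_add hfar ?_)
  have : Fact (2 < N) := ⟨hN⟩
  have : Fact (1 < N) := ⟨by omega⟩
  rw [Finset.sum_insert (by simp), Finset.sum_pair ZMod.neg_one_ne_one.symm, neg_zero,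
    AddChar.map_zero_eq_one, sub_self, zero_smul, zero_add, two_mul]
  exact norm_add_le_of_le (by simpa using hnear 1 rfl) (by simpa using hnear (-1) rfl)

end FiniteFourier

section CommutatorEstimate

open scoped ZMod

variable {A : Type*} [NormedRing A] [NormedAlgebra ℂ A]

/-- The map `x ↦ x * T - T * x`, as a continuous linear map so that it can be applied termwise to
the series `wienerEval`. -/
def commutatorWith (T : A) : A →L[ℂ] A :=
  (ContinuousLinearMap.mul ℂ A).flip T - ContinuousLinearMap.mul ℂ A T

lemma commutatorWith_apply (T x : A) : commutatorWith T x = x * T - T * x := rfl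

variable [CompleteSpace A] {u : AddChar ℤ A} {T : A} {κ ε : ℝ} {N : ℕ} [NeZero N]

lemma wienerEval_tentCoeff_mul_eq_zero (hu : ∀ n, ‖u n‖ ≤ 1) {j k : ZMod N}
    (hjk : j - k ∉ ({0, 1, -1} : Finset (ZMod N))) :
    wienerEval u (tentCoeff N j) * wienerEval u (tentCoeff N k) = 0 :=
  wienerEval_mul_wienerEval_eq_zero u hu (hasSum_norm_tentCoeff N j).summable
    (hasSum_norm_tentCoeff N k).summable (wienerEval_fourierAddChar_tentCoeff_mul_eq_zero N hjk)

lemma norm_commutatorWith_wienerEval_le {a : ℤ → ℂ} {s : ℝ} (hu : ∀ n, ‖u n‖ ≤ 1)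
    (hT : ∀ n, ‖commutatorWith T (u n)‖ ≤ κ) (ha : HasSum (fun n => ‖a n‖) s) :
    ‖commutatorWith T (wienerEval u a)‖ ≤ s * κ := by
  rw [map_wienerEval _ hu ha.summable, ← ha.tsum_eq]
  exact norm_wienerEval_le hT ha.summable

lemma norm_commutatorWith_residueWeight_mul_le (hu : ∀ n, ‖u n‖ ≤ 1)
    (hT : ∀ n, ‖commutatorWith T (u n)‖ ≤ κ) (r s : ZMod N) :
    ‖commutatorWith T (wienerEval u (residueWeight N r)) * wienerEval u (residueWeight N s)‖ ≤
      κ := by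
  have hr := norm_commutatorWith_wienerEval_le hu hT (hasSum_norm_residueWeight N r)
  have hs := norm_wienerEval_le hu (hasSum_norm_residueWeight N s).summable
  rw [(hasSum_norm_residueWeight N s).tsum_eq] at hs
  rw [one_mul] at hr hs
  exact (norm_mul_le _ _).trans ((mul_le_of_le_one_right (norm_nonneg _) hs).trans hr)

/-- Let `β x y = (x * T - T * x) * y`. The discrete Fourier transform expresses `β (a 1) (a (-1))`,
for the residue class evaluations `a`, by the diagonal sums of `β` over the tents, which are at
most `N * ε` off the three middle diagonals; there the coefficients are `O(1 / N)` because the sum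
of all diagonals is `β (a 0) (a 0) = 0`. -/
theorem norm_commutatorWith_residueWeight_one_mul_le (hu : ∀ n, ‖u n‖ ≤ 1)
    (hT : ∀ n, ‖commutatorWith T (u n)‖ ≤ κ) (hN : 3 ≤ N)
    (hε : ∀ j k : ZMod N, j - k ∉ ({0, 1, -1} : Finset (ZMod N)) →
      ‖wienerEval u (tentCoeff N j) * T * wienerEval u (tentCoeff N k)‖ ≤ ε) :
    ‖commutatorWith T (wienerEval u (residueWeight N 1)) *
        wienerEval u (residueWeight N (-1))‖ ≤
      (N - 3) * (2 * (N * ε)) + 2 * (2 * Real.pi / N * κ) := by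
  let β : A →ₗ[ℂ] A →ₗ[ℂ] A := LinearMap.mul ℂ A ∘ₗ (commutatorWith T : A →ₗ[ℂ] A)
  let a : ZMod N → A := fun r => wienerEval u (residueWeight N r)
  let e : ZMod N → A := fun j => wienerEval u (tentCoeff N j)
  have he : e = 𝓕⁻ a := by
    ext j
    rw [invDFT_wienerEval hu fun r => (hasSum_norm_residueWeight N r).summable,
      invDFT_residueWeight]
  have hdft (r : ZMod N) : 𝓕 (cyclicAutocorrelation β e) r = β (a r) (a (-r)) := by
    rw [dft_cyclicAutocorrelation, he, LinearEquiv.apply_symm_apply]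
  change ‖β (a 1) (a (-1))‖ ≤ _
  rw [← hdft]
  refine norm_dft_one_le hN ?_ (fun d => ?_) (fun d hd => ?_)
  · rw [hdft, neg_zero]
    change commutatorWith T (wienerEval u (residueWeight N 0)) * _ = 0
    rw [residueWeight_zero, wienerEval_single, AddChar.map_zero_eq_one, commutatorWith_apply,
      one_mul, mul_one, sub_self, zero_mul]
  · rw [← ZMod.dft.symm_apply_apply (cyclicAutocorrelation β e)]
    refine norm_invDFT_le (fun r => ?_) d
    rw [hdft]
    exact norm_commutatorWith_residueWeight_mul_le hu hT r (-r)
  · refine (norm_sum_le_of_le _ (n := fun _ => ε) fun k _ => ?_).trans_eq (by simp)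
    have hk : k + d - k ∉ ({0, 1, -1} : Finset (ZMod N)) := by rwa [add_sub_cancel_left]
    change ‖(e (k + d) * T - T * e (k + d)) * e k‖ ≤ ε
    rw [sub_mul, mul_assoc T, wienerEval_tentCoeff_mul_eq_zero hu hk, mul_zero, sub_zero]
    exact hε _ _ hk

lemma summable_norm_single (k : ℤ) : Summable fun n => ‖(Pi.single k 1 : ℤ → ℂ) n‖ :=
  (hasSum_single k fun n hn => by rw [Pi.single_eq_of_ne hn, norm_zero]).summable

lemma wienerEval_residueWeight_sub_single (hu : ∀ n, ‖u n‖ ≤ 1) (k : ℤ) :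
    wienerEval u (residueWeight N k - Pi.single k 1) =
      wienerEval u (residueWeight N k) - u k := by
  rw [wienerEval_sub hu (hasSum_norm_residueWeight N k).summable (summable_norm_single k),
    wienerEval_single]

/-- The error terms come from replacing `u 1` and `u (-1)` by the averages over their residue
classes. -/
theorem norm_conj_sub_le (hu : ∀ n, ‖u n‖ ≤ 1) (hT : ∀ n, ‖commutatorWith T (u n)‖ ≤ κ)
    (hN : 3 ≤ N)
    (hε : ∀ j k : ZMod N, j - k ∉ ({0, 1, -1} : Finset (ZMod N)) →
      ‖wienerEval u (tentCoeff N j) * T * wienerEval u (tentCoeff N k)‖ ≤ ε) :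
    ‖u 1 * T * u (-1) - T‖ ≤
      (N - 3) * (2 * (N * ε)) + (4 * Real.pi / N + 4 / 3 * (Real.pi / N) ^ 2) * κ := by
  have hκ : 0 ≤ κ := (norm_nonneg _).trans (hT 0)
  set δ := 2 * (1 - fejerWeight N 1)
  have hδ_le : δ ≤ 2 / 3 * (Real.pi / N) ^ 2 :=
    (mul_le_mul_of_nonneg_left (one_sub_fejerWeight_one_le N) zero_le_two).trans_eq (by ring)
  have hδκ_le : δ * κ ≤ 2 / 3 * (Real.pi / N) ^ 2 * κ := by gcongr
  set p := wienerEval u (residueWeight N 1)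
  set q := wienerEval u (residueWeight N (-1))
  have hp : ‖commutatorWith T p‖ ≤ κ := by
    simpa using norm_commutatorWith_wienerEval_le hu hT (hasSum_norm_residueWeight N 1)
  have hp_sub : ‖commutatorWith T (p - u 1)‖ ≤ δ * κ := by
    have h := norm_commutatorWith_wienerEval_le hu hT (hasSum_norm_residueWeight_sub_single N 1)
    rwa [wienerEval_residueWeight_sub_single hu, Int.cast_one] at h
  have hq_sub : ‖q - u (-1)‖ ≤ δ := by
    have h := norm_wienerEval_le hu (hasSum_norm_residueWeight_sub_single N (-1)).summable
    rwa [(hasSum_norm_residueWeight_sub_single N (-1)).tsum_eq, fejerWeight_neg, mul_one,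
      wienerEval_residueWeight_sub_single hu, Int.cast_neg, Int.cast_one] at h
  have hu_inv : u 1 * u (-1) = 1 := by
    rw [← AddChar.map_add_eq_mul, add_neg_cancel, AddChar.map_zero_eq_one]
  have hsplit : u 1 * T * u (-1) - T = commutatorWith T p * q -
      (commutatorWith T (p - u 1) * u (-1) + commutatorWith T p * (q - u (-1))) := by
    have : u 1 * T * u (-1) - T = commutatorWith T (u 1) * u (-1) := by
      rw [commutatorWith_apply, sub_mul, mul_assoc T, hu_inv, mul_one]
    rw [this, map_sub]
    noncomm_ring
  have hmain := norm_commutatorWith_residueWeight_one_mul_le hu hT hN hε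
  calc ‖u 1 * T * u (-1) - T‖
      ≤ ‖commutatorWith T p * q‖ +
          (‖commutatorWith T (p - u 1)‖ * ‖u (-1)‖ + ‖commutatorWith T p‖ * ‖q - u (-1)‖) := by
        rw [hsplit]
        refine (norm_sub_le _ _).trans ?_
        gcongr
        exact norm_add_le_of_le (norm_mul_le _ _) (norm_mul_le _ _)
    _ ≤ (N - 3) * (2 * (N * ε)) + 2 * (2 * Real.pi / N * κ) + (δ * κ * 1 + κ * δ) := by
        have hδκ : 0 ≤ δ * κ := (norm_nonneg _).trans hp_sub
        gcongr
        exact hu _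
    _ = (N - 3) * (2 * (N * ε)) + 4 * Real.pi / N * κ + 2 * (δ * κ) := by ring
    _ ≤ (N - 3) * (2 * (N * ε)) + (4 * Real.pi / N + 4 / 3 * (Real.pi / N) ^ 2) * κ := by
        linarith

end CommutatorEstimate

section ReflexiveDist

open scoped Pointwise

variable {X : Type*} [NormedAddCommGroup X] [NormedSpace ℂ X] (𝒮 : Submodule ℂ (X →L[ℂ] X))
  (T : X →L[ℂ] X)

lemma zero_mem_opOrbit (x : X) : (0 : X) ∈ opOrbit 𝒮 x := ⟨0, 𝒮.zero_mem, rfl⟩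

lemma opOrbit_smul (c : ℂ) (x : X) : opOrbit 𝒮 (c • x) = c • opOrbit 𝒮 x := by
  simp only [opOrbit, map_smul, ← Set.image_smul, Set.image_image]

lemma bddAbove_infDist_opOrbit :
    BddAbove (Set.range fun x : Metric.closedBall (0 : X) 1 =>
      Metric.infDist (T x) (opOrbit 𝒮 x)) := by
  refine ⟨‖T‖, Set.forall_mem_range.mpr fun x => ?_⟩
  refine (Metric.infDist_le_dist_of_mem (zero_mem_opOrbit 𝒮 (x : X))).trans ?_
  rw [dist_zero_right]
  exact T.unit_le_opNorm _ (mem_closedBall_zero_iff.mp x.2)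

lemma reflexiveDist_nonneg : 0 ≤ reflexiveDist 𝒮 T :=
  Real.iSup_nonneg fun _ => Metric.infDist_nonneg

lemma infDist_opOrbit_le (x : X) :
    Metric.infDist (T x) (opOrbit 𝒮 x) ≤ reflexiveDist 𝒮 T * ‖x‖ := by
  rcases eq_or_ne x 0 with rfl | hx
  · simpa using Metric.infDist_le_dist_of_mem (x := T 0) (zero_mem_opOrbit 𝒮 (0 : X))
  have hx_pos : 0 < ‖x‖ := norm_pos_iff.mpr hx
  have hc : (‖x‖ : ℂ)⁻¹ ≠ 0 := by simpa using hx
  have h : Metric.infDist (T ((‖x‖ : ℂ)⁻¹ • x)) (opOrbit 𝒮 ((‖x‖ : ℂ)⁻¹ • x)) ≤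
      reflexiveDist 𝒮 T :=
    le_ciSup (bddAbove_infDist_opOrbit 𝒮 T)
      ⟨_, mem_closedBall_zero_iff.mpr (norm_smul_inv_norm hx).le⟩
  rwa [opOrbit_smul, map_smul, infDist_smul₀ hc, norm_inv, Complex.norm_real, norm_norm,
    inv_mul_le_iff₀' hx_pos] at h

end ReflexiveDist

section Representation

variable {X : Type*} [NormedAddCommGroup X] [NormedSpace ℂ X] {𝒮 : Submodule ℂ (X →L[ℂ] X)}
  {T : X →L[ℂ] X} {ε : ℝ}

lemma norm_mul_mul_le_of_commute {E F : X →L[ℂ] X} (hε : 0 ≤ ε)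
    (hT : ∀ x, Metric.infDist (T x) (opOrbit 𝒮 x) ≤ ε * ‖x‖) (hE : ‖E‖ ≤ 1)
    (hF : ‖F‖ ≤ 1) (hEF : E * F = 0) (hSF : ∀ S ∈ 𝒮, Commute S F) : ‖E * T * F‖ ≤ ε := by
  refine ContinuousLinearMap.opNorm_le_bound _ hε fun x => ?_
  calc ‖(E * T * F) x‖ ≤ Metric.infDist (T (F x)) (opOrbit 𝒮 (F x)) := by
        refine (Metric.le_infDist ⟨0, zero_mem_opOrbit 𝒮 _⟩).mpr ?_
        rintro _ ⟨S, hS, rfl⟩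
        have hESF : E * (S * F) = 0 := by rw [(hSF S hS).eq, ← mul_assoc, hEF, zero_mul]
        have : (E * T * F) x = E (T (F x) - S (F x)) := by
          rw [map_sub, show E (S (F x)) = 0 from DFunLike.congr_fun hESF x, sub_zero]
          rfl
        rw [this, dist_eq_norm]
        exact E.le_of_opNorm_le hE _ |>.trans_eq (one_mul _)
    _ ≤ ε * ‖F x‖ := hT _
    _ ≤ ε * ‖x‖ := by
        gcongr
        exact F.le_of_opNorm_le hF _ |>.trans_eq (one_mul _)

variable {G : Type*} [Group G] {ρ : G →* (X →L[ℂ] X)}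

lemma norm_conj_sub_le_two_mul_norm (hρ : ∀ t, ‖ρ t‖ ≤ 1) (t : G) :
    ‖ρ t * T * ρ t⁻¹ - T‖ ≤ 2 * ‖T‖ :=
  calc ‖ρ t * T * ρ t⁻¹ - T‖ ≤ ‖ρ t‖ * ‖T‖ * ‖ρ t⁻¹‖ + ‖T‖ :=
        (norm_sub_le _ _).trans (by gcongr; exact norm_mul₃_le)
    _ ≤ 1 * ‖T‖ * 1 + ‖T‖ := by gcongr <;> exact hρ _
    _ = 2 * ‖T‖ := by ring

lemma commutatorWith_eq_conj_sub_mul (t : G) :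
    commutatorWith T (ρ t) = (ρ t * T * ρ t⁻¹ - T) * ρ t := by
  rw [commutatorWith_apply, sub_mul, mul_assoc (ρ t * T), ← map_mul, inv_mul_cancel, map_one,
    mul_one]

lemma norm_commutatorWith_le_norm_conj_sub (hρ : ∀ t, ‖ρ t‖ ≤ 1) (t : G) :
    ‖commutatorWith T (ρ t)‖ ≤ ‖ρ t * T * ρ t⁻¹ - T‖ := by
  rw [commutatorWith_eq_conj_sub_mul]
  exact (norm_mul_le _ _).trans (mul_le_of_le_one_right (norm_nonneg _) (hρ t))

lemma norm_conj_sub_le_of_infDist_le [CompleteSpace X] (hρ : ∀ t, ‖ρ t‖ ≤ 1)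
    (h𝒮 : ∀ S ∈ 𝒮, ∀ t, Commute S (ρ t)) (hε : 0 ≤ ε)
    (hT : ∀ x, Metric.infDist (T x) (opOrbit 𝒮 x) ≤ ε * ‖x‖) {κ : ℝ}
    (hκ : ∀ t, ‖commutatorWith T (ρ t)‖ ≤ κ) {N : ℕ} (hN : 3 ≤ N) (t : G) :
    ‖ρ t * T * ρ t⁻¹ - T‖ ≤
      (N - 3) * (2 * (N * ε)) + (4 * Real.pi / N + 4 / 3 * (Real.pi / N) ^ 2) * κ := by
  have : NeZero N := ⟨by omega⟩
  let u : AddChar ℤ (X →L[ℂ] X) := AddChar.toMonoidHomEquiv.symm (ρ.comp (zpowersHom G t))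
  have hu_apply (n : ℤ) : u n = ρ (t ^ n) := rfl
  have hu (n : ℤ) : ‖u n‖ ≤ 1 := hρ _
  have htent (j : ZMod N) : ‖wienerEval u (tentCoeff N j)‖ ≤ 1 := by
    simpa [(hasSum_norm_tentCoeff N j).tsum_eq] using
      norm_wienerEval_le hu (hasSum_norm_tentCoeff N j).summable
  have h := norm_conj_sub_le hu (fun n => hκ (t ^ n)) hN fun j k hjk =>
    norm_mul_mul_le_of_commute hε hT (htent j) (htent k) (wienerEval_tentCoeff_mul_eq_zero hu hjk)
      fun S hS => commute_wienerEval hu (fun n => h𝒮 S hS (t ^ n))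
        (hasSum_norm_tentCoeff N k).summable
  rwa [hu_apply, hu_apply, zpow_one, zpow_neg_one] at h

lemma le_mul_one_sub_bootstrapRatio :
    (20 - 3) * (2 * 20) ≤ 288 * Real.pi * (1 + √2) *
      (1 - (4 * Real.pi / 20 + 4 / 3 * (Real.pi / 20) ^ 2)) := by
  have hpi_gt := Real.pi_gt_d2
  have hpi_lt := Real.pi_lt_d2
  have hsqrt : (1.41 : ℝ) ≤ √2 := Real.le_sqrt_of_sq_le (by norm_num)
  have hratio : (1 / 3 : ℝ) ≤ 1 - (4 * Real.pi / 20 + 4 / 3 * (Real.pi / 20) ^ 2) := by nlinarith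
  have hconst : (2040 : ℝ) ≤ 288 * Real.pi * (1 + √2) := by nlinarith
  calc ((20 - 3) * (2 * 20) : ℝ) = 2040 * (1 / 3) := by norm_num
    _ ≤ 288 * Real.pi * (1 + √2) *
          (1 - (4 * Real.pi / 20 + 4 / 3 * (Real.pi / 20) ^ 2)) :=
        mul_le_mul hconst hratio (by norm_num) (by positivity)

/-- The estimate `norm_conj_sub_le_of_infDist_le` with `N = 20` is self-improving: its coefficient
of `κ` is less than `1`, so it bounds the supremum `κ` of its own left hand sides. -/
theorem norm_conj_sub_le_mul_of_infDist_le [CompleteSpace X] (hρ : ∀ t, ‖ρ t‖ ≤ 1)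
    (h𝒮 : ∀ S ∈ 𝒮, ∀ t, Commute S (ρ t)) (hε : 0 ≤ ε)
    (hT : ∀ x, Metric.infDist (T x) (opOrbit 𝒮 x) ≤ ε * ‖x‖) (t : G) :
    ‖ρ t * T * ρ t⁻¹ - T‖ ≤ 288 * Real.pi * (1 + √2) * ε := by
  have hbdd : BddAbove (Set.range fun t => ‖ρ t * T * ρ t⁻¹ - T‖) :=
    ⟨2 * ‖T‖, Set.forall_mem_range.mpr (norm_conj_sub_le_two_mul_norm hρ)⟩
  set κ := ⨆ t, ‖ρ t * T * ρ t⁻¹ - T‖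
  have hκ (s : G) : ‖ρ s * T * ρ s⁻¹ - T‖ ≤ κ := le_ciSup hbdd s
  set q := 4 * Real.pi / 20 + 4 / 3 * (Real.pi / 20) ^ 2
  set K := 288 * Real.pi * (1 + √2)
  have hself : κ ≤ (20 - 3) * (2 * (20 * ε)) + q * κ := ciSup_le fun s => by
    simpa using norm_conj_sub_le_of_infDist_le hρ h𝒮 hε hT
      (fun t => (norm_commutatorWith_le_norm_conj_sub hρ t).trans (hκ t))
      (N := 20) (by norm_num) s
  have hK : (20 - 3) * (2 * 20) ≤ K * (1 - q) := le_mul_one_sub_bootstrapRatio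
  have hq_lt : 0 < 1 - q := pos_of_mul_pos_right (lt_of_lt_of_le (by norm_num) hK) (by positivity)
  refine (hκ t).trans (le_of_mul_le_mul_left ?_ hq_lt)
  calc (1 - q) * κ ≤ (20 - 3) * (2 * 20) * ε := by linarith
    _ ≤ K * (1 - q) * ε := by gcongr
    _ = (1 - q) * (K * ε) := by ring

end Representation

section MilmanPettis

variable {𝕜 E : Type*} [RCLike 𝕜] [NormedAddCommGroup E] [NormedSpace 𝕜 E]

lemma norm_dual_le_of_re_le {f : StrongDual 𝕜 E} {c : ℝ} (hc : 0 ≤ c)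
    (h : ∀ x, ‖x‖ ≤ 1 → RCLike.re (f x) ≤ c) : ‖f‖ ≤ c := by
  refine ContinuousLinearMap.opNorm_le_of_unit_norm hc fun x hx => ?_
  obtain ⟨z, hz, hzf⟩ := RCLike.exists_norm_eq_mul_self (f x)
  calc ‖f x‖ = RCLike.re (f (z • x)) := by
        rw [map_smul, smul_eq_mul, ← hzf, RCLike.ofReal_re]
    _ ≤ c := h _ (by rw [norm_smul, hz, hx, one_mul])

lemma mem_closure_image_of_forall_re_le {V W : Type*} [AddCommGroup V] [Module 𝕜 V] [Module ℝ V]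
    [IsScalarTower ℝ 𝕜 V] [AddCommGroup W] [Module 𝕜 W] (B : V →ₗ[𝕜] W →ₗ[𝕜] 𝕜)
    {s : Set V} (hs : Convex ℝ s) (ψ : W →ₗ[𝕜] 𝕜)
    (hψ : ∀ (w : W) (c : ℝ), (∀ v ∈ s, RCLike.re (B v w) ≤ c) → RCLike.re (ψ w) ≤ c) :
    ⇑ψ ∈ closure ((fun v w => B v w) '' s) := by
  let D : (W →ₗ[𝕜] 𝕜) →ₗ[𝕜] W →ₗ[𝕜] 𝕜 := LinearMap.id
  let ι : V →ₗ[ℝ] WeakBilin D := B.restrictScalars ℝ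
  let Ψ : WeakBilin D := ψ
  have : ContinuousSMul ℝ (WeakBilin D) := IsScalarTower.continuousSMul 𝕜
  suffices h : Ψ ∈ closure (ι '' s) by
    have := mem_closure_image (WeakBilin.coeFn_continuous D).continuousAt h
    rwa [Set.image_image] at this
  by_contra hmem
  obtain ⟨Φ, c, hΦ, hΦΨ⟩ := RCLike.geometric_hahn_banach_closed_point (𝕜 := 𝕜)
    (hs.linear_image ι).closure isClosed_closure hmem
  obtain ⟨w, rfl⟩ := LinearMap.dualEmbedding_surjective D Φ
  exact hΦΨ.not_ge (hψ w c fun v hv => (hΦ (ι v) (subset_closure ⟨v, hv, rfl⟩)).le)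

/-- **Goldstine's theorem** -/
theorem bidual_mem_closure_image_closedBall {Ψ : StrongDual 𝕜 (StrongDual 𝕜 E)} (hΨ : ‖Ψ‖ ≤ 1) :
    ⇑Ψ ∈ closure ((fun (x : E) (φ : StrongDual 𝕜 E) => φ x) '' Metric.closedBall 0 1) := by
  let _ : NormedSpace ℝ E := .restrictScalars ℝ 𝕜 E
  have : IsScalarTower ℝ 𝕜 E := .of_algebraMap_smul fun _ _ => rfl
  refine mem_closure_image_of_forall_re_le (topDualPairing 𝕜 E).flip (convex_closedBall 0 1)
    (Ψ : StrongDual 𝕜 E →ₗ[𝕜] 𝕜) fun φ c hφ => ?_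
  replace hφ (x : E) (hx : ‖x‖ ≤ 1) : RCLike.re (φ x) ≤ c :=
    hφ x (mem_closedBall_zero_iff.mpr hx)
  have hc : 0 ≤ c := by simpa using hφ 0 (by simp)
  calc RCLike.re (Ψ φ) ≤ ‖Ψ φ‖ := RCLike.re_le_norm _
    _ ≤ ‖φ‖ := Ψ.le_of_opNorm_le hΨ φ |>.trans_eq (one_mul _)
    _ ≤ c := norm_dual_le_of_re_le hc hφ

lemma exists_ultrafilter_tendsto_dual {Ψ : StrongDual 𝕜 (StrongDual 𝕜 E)} (hΨ : ‖Ψ‖ ≤ 1) :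
    ∃ F : Ultrafilter E, Metric.closedBall 0 1 ∈ F ∧
      ∀ φ : StrongDual 𝕜 E, Filter.Tendsto φ F (nhds (Ψ φ)) := by
  have hmem := bidual_mem_closure_image_closedBall hΨ
  rw [mem_closure_iff_clusterPt, ← Filter.map_principal] at hmem
  obtain ⟨F, hball, hlim⟩ := mapClusterPt_iff_ultrafilter.mp hmem
  exact ⟨F, Filter.le_principal_iff.mp hball,
    fun φ => ((continuous_apply φ).tendsto _).comp hlim⟩

lemma cauchy_of_tendsto_dual [UniformConvexSpace E] {Ψ : StrongDual 𝕜 (StrongDual 𝕜 E)}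
    (hΨ : ‖Ψ‖ = 1) {F : Filter E} [F.NeBot] (hball : Metric.closedBall 0 1 ∈ F)
    (hlim : ∀ φ : StrongDual 𝕜 E, Filter.Tendsto φ F (nhds (Ψ φ))) : Cauchy F := by
  let _ : NormedSpace ℝ E := .restrictScalars ℝ 𝕜 E
  refine Metric.cauchy_iff.mpr ⟨inferInstance, fun ε hε => ?_⟩
  obtain ⟨δ, hδ, hconv⟩ := exists_forall_closed_ball_dist_add_le_two_sub E hε
  obtain ⟨φ, hφ, hφΨ⟩ : ∃ φ : StrongDual 𝕜 E, ‖φ‖ ≤ 1 ∧ 1 - δ / 2 < RCLike.re (Ψ φ) := by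
    by_contra! hcon
    have hle := norm_dual_le_of_re_le (le_max_right (1 - δ / 2) 0)
      fun φ hφ => (hcon φ hφ).trans (le_max_left _ _)
    rw [hΨ, le_max_iff] at hle
    rcases hle with h | h <;> linarith
  have hev : ∀ᶠ x in F, 1 - δ / 2 < RCLike.re (φ x) :=
    ((RCLike.continuous_re.tendsto _).comp (hlim φ)).eventually (lt_mem_nhds hφΨ)
  refine ⟨_, Filter.inter_mem hev hball, fun x hx y hy => ?_⟩
  by_contra! hxy
  rw [dist_eq_norm] at hxy
  have hadd_le := hconv (mem_closedBall_zero_iff.mp hx.2) (mem_closedBall_zero_iff.mp hy.2) hxy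
  have hre_le : RCLike.re (φ (x + y)) ≤ ‖x + y‖ := (RCLike.re_le_norm _).trans
    (φ.le_of_opNorm_le hφ _ |>.trans_eq (one_mul _))
  rw [map_add, map_add] at hre_le
  have hx_re : 1 - δ / 2 < RCLike.re (φ x) := hx.1
  have hy_re : 1 - δ / 2 < RCLike.re (φ y) := hy.1
  linarith

/-- **Milman–Pettis theorem** -/
theorem inclusionInDoubleDual_surjective [CompleteSpace E] [UniformConvexSpace E] :
    Function.Surjective (NormedSpace.inclusionInDoubleDual 𝕜 E) := by
  intro Ψ
  rcases eq_or_ne Ψ 0 with rfl | hΨ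
  · exact ⟨0, map_zero _⟩
  have hΨ_norm : (‖Ψ‖ : 𝕜) ≠ 0 :=
    RCLike.ofReal_ne_zero.mpr (norm_ne_zero_iff (E := StrongDual 𝕜 (StrongDual 𝕜 E)).mpr hΨ)
  have hnorm : ‖(‖Ψ‖ : 𝕜)⁻¹ • Ψ‖ = 1 :=
    norm_smul_inv_norm (𝕜 := 𝕜) (E := StrongDual 𝕜 (StrongDual 𝕜 E)) hΨ
  obtain ⟨F, hball, hlim⟩ := exists_ultrafilter_tendsto_dual hnorm.le
  obtain ⟨x, hx⟩ := CompleteSpace.complete (cauchy_of_tendsto_dual hnorm hball hlim)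
  have hx_eq : NormedSpace.inclusionInDoubleDual 𝕜 E x = (‖Ψ‖ : 𝕜)⁻¹ • Ψ :=
    ContinuousLinearMap.ext fun φ =>
      tendsto_nhds_unique ((φ.continuous.tendsto x).mono_left hx) (hlim φ)
  refine ⟨(‖Ψ‖ : 𝕜) • x, ?_⟩
  rw [map_smul, hx_eq, smul_inv_smul₀ hΨ_norm]

end MilmanPettis

section Averaging

variable {𝕜 G X : Type*} [RCLike 𝕜] [Group G]
  [NormedAddCommGroup X] [NormedSpace 𝕜 X]

lemma exists_forall_dual_apply_eq
    (hX : Function.Surjective (NormedSpace.inclusionInDoubleDual 𝕜 X))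
    (B : X →L[𝕜] StrongDual 𝕜 X →L[𝕜] 𝕜) :
    ∃ S : X →L[𝕜] X, ∀ (x : X) (φ : StrongDual 𝕜 X), φ (S x) = B x φ := by
  let e : X ≃ₗᵢ[𝕜] StrongDual 𝕜 (StrongDual 𝕜 X) :=
    LinearIsometryEquiv.ofSurjective (NormedSpace.inclusionInDoubleDualLi 𝕜) hX
  refine ⟨(e.symm : StrongDual 𝕜 (StrongDual 𝕜 X) →L[𝕜] X).comp B, fun x φ => ?_⟩
  exact congrArg (fun Φ : StrongDual 𝕜 (StrongDual 𝕜 X) => Φ φ) (e.apply_symm_apply (B x))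

lemma norm_conj_apply_le {ρ : G →* (X →L[𝕜] X)} (hρ : ∀ t, ‖ρ t‖ ≤ 1) (T : X →L[𝕜] X) (x : X)
    (t : G) : ‖ρ t (T (ρ t⁻¹ x))‖ ≤ ‖T‖ * ‖x‖ :=
  calc ‖ρ t (T (ρ t⁻¹ x))‖ ≤ ‖T (ρ t⁻¹ x)‖ :=
        (ρ t).le_of_opNorm_le (hρ t) _ |>.trans_eq (one_mul _)
    _ ≤ ‖T‖ * ‖ρ t⁻¹ x‖ := T.le_opNorm _
    _ ≤ ‖T‖ * ‖x‖ := by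
        gcongr
        exact (ρ t⁻¹).le_of_opNorm_le (hρ t⁻¹) x |>.trans_eq (one_mul _)

variable [TopologicalSpace G] [IsTopologicalGroup G]

lemma continuous_conj_apply {ρ : G →* (X →L[𝕜] X)} (hρ : ∀ t, ‖ρ t‖ ≤ 1)
    (hcont : ∀ x, Continuous fun t => ρ t x) (T : X →L[𝕜] X) (x : X) :
    Continuous fun t => ρ t (T (ρ t⁻¹ x)) := by
  have hjoint : Continuous fun z : X × G => ρ z.2 z.1 :=
    continuous_prod_of_continuous_lipschitzWith _ 1 hcont fun t =>
      (ρ t).lipschitz.weaken (hρ t)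
  exact hjoint.comp <|
    (T.continuous.comp ((hcont x).comp continuous_inv)).prodMk continuous_id

/-- The coefficients `t ↦ φ (ρ t T ρ t⁻¹ x)` of the conjugates of `T` under a contractive
representation `ρ`, as bounded continuous functions, so that a mean can be applied to them. -/
def conjCoeff {ρ : G →* (X →L[𝕜] X)} (hρ : ∀ t, ‖ρ t‖ ≤ 1)
    (hcont : ∀ x, Continuous fun t => ρ t x) (T : X →L[𝕜] X) (x : X) (φ : StrongDual 𝕜 X) :
    G →ᵇ 𝕜 :=
  BoundedContinuousFunction.ofNormedAddCommGroup (fun t => φ (ρ t (T (ρ t⁻¹ x))))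
    (φ.continuous.comp (continuous_conj_apply hρ hcont T x)) (‖T‖ * ‖x‖ * ‖φ‖) fun t =>
      (φ.le_opNorm_of_le (norm_conj_apply_le hρ T x t)).trans_eq (mul_comm _ _)

variable {ρ : G →* (X →L[𝕜] X)} (hρ : ∀ t, ‖ρ t‖ ≤ 1)
  (hcont : ∀ x, Continuous fun t => ρ t x) (T : X →L[𝕜] X)

lemma conjCoeff_apply (x : X) (φ : StrongDual 𝕜 X) (t : G) :
    conjCoeff hρ hcont T x φ t = φ (ρ t (T (ρ t⁻¹ x))) :=
  rfl

lemma norm_conjCoeff_le (x : X) (φ : StrongDual 𝕜 X) :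
    ‖conjCoeff hρ hcont T x φ‖ ≤ ‖T‖ * ‖x‖ * ‖φ‖ :=
  BoundedContinuousFunction.norm_ofNormedAddCommGroup_le _ (by positivity) _

lemma conjCoeff_comp_mulLeft (s : G) (x : X) (φ : StrongDual 𝕜 X) :
    (conjCoeff hρ hcont T (ρ s x) φ).compContinuous (ContinuousMap.mulLeft s) =
      conjCoeff hρ hcont T x (φ.comp (ρ s)) := by
  ext t
  have hinv : ρ (s * t)⁻¹ (ρ s x) = ρ t⁻¹ x := by
    rw [← mul_apply_eq_comp, ← map_mul, mul_inv_rev, inv_mul_cancel_right]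
  change φ (ρ (s * t) (T (ρ (s * t)⁻¹ (ρ s x)))) = φ (ρ s (ρ t (T (ρ t⁻¹ x))))
  rw [hinv, map_mul, mul_apply_eq_comp]

lemma norm_smul_one_sub_conjCoeff_le {c : ℝ} (hc : ∀ t, ‖ρ t * T * ρ t⁻¹ - T‖ ≤ c) (x : X)
    (φ : StrongDual 𝕜 X) :
    ‖φ (T x) • (1 : G →ᵇ 𝕜) - conjCoeff hρ hcont T x φ‖ ≤ c * ‖x‖ * ‖φ‖ := by
  have hc0 : 0 ≤ c := (norm_nonneg _).trans (hc 1)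
  refine (BoundedContinuousFunction.norm_le (by positivity)).mpr fun t => ?_
  calc ‖(φ (T x) • (1 : G →ᵇ 𝕜) - conjCoeff hρ hcont T x φ) t‖
      = ‖φ ((ρ t * T * ρ t⁻¹ - T) x)‖ := by
        rw [← norm_neg]
        simp [conjCoeff_apply]
    _ ≤ ‖φ‖ * (c * ‖x‖) := φ.le_opNorm_of_le (ContinuousLinearMap.le_of_opNorm_le _ (hc t) x)
    _ = c * ‖x‖ * ‖φ‖ := mul_comm _ _

lemma exists_forall_dual_apply_eq_map_conjCoeff
    (hX : Function.Surjective (NormedSpace.inclusionInDoubleDual 𝕜 X))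
    (m : (G →ᵇ 𝕜) →L[𝕜] 𝕜) :
    ∃ S : X →L[𝕜] X, ∀ (x : X) (φ : StrongDual 𝕜 X), φ (S x) = m (conjCoeff hρ hcont T x φ) :=
  exists_forall_dual_apply_eq hX <| LinearMap.mkContinuous₂
    (LinearMap.mk₂ 𝕜 (fun x φ => m (conjCoeff hρ hcont T x φ))
      (fun x y φ => by rw [← map_add]; congr 1; ext t; simp [conjCoeff_apply])
      (fun a x φ => by rw [← map_smul]; congr 1; ext t; simp [conjCoeff_apply])
      (fun x φ ψ => by rw [← map_add]; congr 1)
      (fun a x φ => by rw [← map_smul]; congr 1))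
    (‖m‖ * ‖T‖) fun x φ =>
      calc ‖m (conjCoeff hρ hcont T x φ)‖ ≤ ‖m‖ * (‖T‖ * ‖x‖ * ‖φ‖) :=
            m.le_opNorm_of_le (norm_conjCoeff_le hρ hcont T x φ)
        _ = ‖m‖ * ‖T‖ * ‖x‖ * ‖φ‖ := by ring

variable {hρ hcont T} {m : (G →ᵇ 𝕜) →L[𝕜] 𝕜} {S : X →L[𝕜] X}

lemma commute_of_forall_dual_apply_eq
    (hm : ∀ (t : G) (f : G →ᵇ 𝕜), m (f.compContinuous (ContinuousMap.mulLeft t)) = m f)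
    (hS : ∀ (x : X) (φ : StrongDual 𝕜 X), φ (S x) = m (conjCoeff hρ hcont T x φ)) (s : G) :
    Commute S (ρ s) := by
  refine ContinuousLinearMap.ext fun x =>
    SeparatingDual.eq_iff_forall_dual_eq (R := 𝕜) |>.mpr fun φ => ?_
  calc φ (S (ρ s x)) = m (conjCoeff hρ hcont T (ρ s x) φ) := hS _ _
    _ = m (conjCoeff hρ hcont T x (φ.comp (ρ s))) := by rw [← hm s, conjCoeff_comp_mulLeft]
    _ = φ (ρ s (S x)) := (hS x (φ.comp (ρ s))).symm

lemma norm_sub_le_of_forall_dual_apply_eq (hm : ‖m‖ ≤ 1) (hm_one : m 1 = 1)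
    (hS : ∀ (x : X) (φ : StrongDual 𝕜 X), φ (S x) = m (conjCoeff hρ hcont T x φ))
    {c : ℝ} (hc : ∀ t, ‖ρ t * T * ρ t⁻¹ - T‖ ≤ c) : ‖T - S‖ ≤ c := by
  have hc0 : 0 ≤ c := (norm_nonneg _).trans (hc 1)
  refine ContinuousLinearMap.opNorm_le_bound _ hc0 fun x =>
    NormedSpace.norm_le_dual_bound 𝕜 _ (by positivity) fun φ => ?_
  calc ‖φ ((T - S) x)‖ = ‖m (φ (T x) • 1 - conjCoeff hρ hcont T x φ)‖ := by
        rw [map_sub, map_smul, hm_one, smul_eq_mul, mul_one, ← hS, _root_.sub_apply, map_sub]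
    _ ≤ ‖φ (T x) • 1 - conjCoeff hρ hcont T x φ‖ :=
        m.le_of_opNorm_le hm _ |>.trans_eq (one_mul _)
    _ ≤ c * ‖x‖ * ‖φ‖ := norm_smul_one_sub_conjCoeff_le hρ hcont T hc x φ

theorem exists_commute_norm_sub_le {X : Type*} [NormedAddCommGroup X] [NormedSpace ℂ X]
    (hX : Function.Surjective (NormedSpace.inclusionInDoubleDual ℂ X)) (hG : IsAmenableGroup G)
    {ρ : G →* (X →L[ℂ] X)} (hρ : ∀ t, ‖ρ t‖ ≤ 1) (hcont : ∀ x, Continuous fun t => ρ t x)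
    (T : X →L[ℂ] X) {c : ℝ} (hc : ∀ t, ‖ρ t * T * ρ t⁻¹ - T‖ ≤ c) :
    ∃ S : X →L[ℂ] X, (∀ t, Commute S (ρ t)) ∧ ‖T - S‖ ≤ c := by
  obtain ⟨m, hm, hm_one, hm_invariant⟩ := hG
  obtain ⟨S, hS⟩ := exists_forall_dual_apply_eq_map_conjCoeff hρ hcont T hX m
  exact ⟨S, commute_of_forall_dual_apply_eq hm_invariant hS,
    norm_sub_le_of_forall_dual_apply_eq hm.le hm_one hS hc⟩

end Averaging

section UniformConvexity

variable {E : Type*} [NormedAddCommGroup E] [NormedSpace ℝ E] {q : ℝ}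

/-- The defect of `‖·‖ ^ q` in midpoint convexity; comparing it with `‖a - b‖ ^ q` measures
uniform convexity in a form that can be integrated. -/
def midpointDefect (q : ℝ) (a b : E) : ℝ :=
  (‖a‖ ^ q + ‖b‖ ^ q) / 2 - ‖(1 / 2 : ℝ) • (a + b)‖ ^ q

lemma midpointDefect_self (q : ℝ) (a : E) : midpointDefect q a a = 0 := by
  rw [midpointDefect, ← two_smul ℝ a, smul_smul, one_div, inv_mul_cancel₀ two_ne_zero, one_smul,
    add_self_div_two, sub_self]

lemma norm_smul_rpow {r : ℝ} (hr : 0 ≤ r) (a : E) : ‖r • a‖ ^ q = r ^ q * ‖a‖ ^ q := by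
  rw [norm_smul_of_nonneg hr, Real.mul_rpow hr (norm_nonneg a)]

lemma midpointDefect_smul {r : ℝ} (hr : 0 ≤ r) (a b : E) :
    midpointDefect q (r • a) (r • b) = r ^ q * midpointDefect q a b := by
  simp only [midpointDefect, ← smul_add, smul_comm _ r, norm_smul_rpow hr]
  ring

lemma midpointDefect_pos [StrictConvexSpace ℝ E] (hq : 1 < q) {a b : E} (hab : a ≠ b) :
    0 < midpointDefect q a b := by
  refine sub_pos.mpr ?_
  by_cases hnorm : ‖a‖ = ‖b‖
  · calc ‖(1 / 2 : ℝ) • (a + b)‖ ^ q < ‖a‖ ^ q :=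
          Real.rpow_lt_rpow (norm_nonneg _) ((norm_midpoint_lt_iff hnorm).mpr hab) (by linarith)
      _ = (‖a‖ ^ q + ‖b‖ ^ q) / 2 := by rw [← hnorm, add_self_div_two]
  · have hnorm_le : ‖(1 / 2 : ℝ) • (a + b)‖ ≤ 1 / 2 * ‖a‖ + 1 / 2 * ‖b‖ := by
      rw [norm_smul_of_nonneg one_half_pos.le, ← mul_add]
      gcongr
      exact norm_add_le a b
    calc ‖(1 / 2 : ℝ) • (a + b)‖ ^ q ≤ (1 / 2 * ‖a‖ + 1 / 2 * ‖b‖) ^ q :=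
          Real.rpow_le_rpow (norm_nonneg _) hnorm_le (by linarith)
      _ < 1 / 2 * ‖a‖ ^ q + 1 / 2 * ‖b‖ ^ q :=
          (strictConvexOn_rpow hq).2 (Set.mem_Ici.mpr (norm_nonneg a))
            (Set.mem_Ici.mpr (norm_nonneg b)) hnorm one_half_pos one_half_pos (add_halves 1)
      _ = (‖a‖ ^ q + ‖b‖ ^ q) / 2 := by ring

lemma midpointDefect_nonneg [StrictConvexSpace ℝ E] (hq : 1 < q) (a b : E) :
    0 ≤ midpointDefect q a b := by
  rcases eq_or_ne a b with rfl | hab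
  · exact (midpointDefect_self q a).ge
  · exact (midpointDefect_pos hq hab).le

lemma exists_le_midpointDefect_of_norm_eq_one [StrictConvexSpace ℝ E] [ProperSpace E] (hq : 1 < q)
    {η : ℝ} (hη : 0 < η) :
    ∃ d, 0 < d ∧ ∀ a b : E, ‖(a, b)‖ = 1 → η * (‖a‖ ^ q + ‖b‖ ^ q) ≤ ‖a - b‖ ^ q →
      d ≤ midpointDefect q a b := by
  have hq0 : 0 < q := by linarith
  have hpow {f : E × E → E} (hf : Continuous f) : Continuous fun z => ‖f z‖ ^ q :=
    hf.norm.rpow_const fun _ => Or.inr hq0.le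
  have hdefect : Continuous fun z : E × E => midpointDefect q z.1 z.2 :=
    (((hpow continuous_fst).add (hpow continuous_snd)).div_const 2).sub
      (hpow ((continuous_fst.add continuous_snd).const_smul _))
  let K : Set (E × E) := Metric.sphere 0 1 ∩
    {z | η * (‖z.1‖ ^ q + ‖z.2‖ ^ q) ≤ ‖z.1 - z.2‖ ^ q}
  have hK : IsCompact K := (isCompact_sphere 0 1).inter_right <| isClosed_le
    (((hpow continuous_fst).add (hpow continuous_snd)).const_mul η)
    (hpow (continuous_fst.sub continuous_snd))
  have hK_pos : ∀ z ∈ K, 0 < midpointDefect q z.1 z.2 := by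
    rintro ⟨a, b⟩ ⟨hsphere, hfar⟩
    refine midpointDefect_pos hq ?_
    rintro (rfl : a = b)
    have ha : ‖a‖ = 1 := by simpa [Prod.norm_def] using hsphere
    simp only [Set.mem_ofPred_eq, sub_self, norm_zero, Real.zero_rpow hq0.ne', ha,
      Real.one_rpow] at hfar
    linarith
  obtain ⟨d, hd, hdK⟩ := hK.exists_forall_le' hdefect.continuousOn hK_pos
  exact ⟨d, hd, fun a b hnorm hfar => hdK (a, b) ⟨mem_sphere_zero_iff_norm.mpr hnorm, hfar⟩⟩

lemma exists_mul_norm_rpow_le_midpointDefect [StrictConvexSpace ℝ E] [ProperSpace E] (hq : 1 < q)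
    {η : ℝ} (hη : 0 < η) :
    ∃ d, 0 < d ∧ ∀ a b : E, η * (‖a‖ ^ q + ‖b‖ ^ q) ≤ ‖a - b‖ ^ q →
      d * ‖(a, b)‖ ^ q ≤ midpointDefect q a b := by
  obtain ⟨d, hd, hle⟩ := exists_le_midpointDefect_of_norm_eq_one (E := E) hq hη
  refine ⟨d, hd, fun a b hfar => ?_⟩
  rcases eq_or_ne (a, b) 0 with hzero | hne
  · obtain ⟨rfl, rfl⟩ := Prod.mk_eq_zero.mp hzero
    simp [midpointDefect_self, Real.zero_rpow (zero_lt_one.trans hq).ne']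
  have hr : 0 < ‖(a, b)‖ := norm_pos_iff.mpr hne
  have hr_inv : 0 ≤ ‖(a, b)‖⁻¹ := inv_nonneg.mpr hr.le
  have hscaled : d ≤ midpointDefect q (‖(a, b)‖⁻¹ • a) (‖(a, b)‖⁻¹ • b) := by
    refine hle _ _ ?_ ?_
    · rw [← Prod.smul_mk, norm_smul_of_nonneg hr_inv, inv_mul_cancel₀ hr.ne']
    · rw [← smul_sub, norm_smul_rpow hr_inv, norm_smul_rpow hr_inv, norm_smul_rpow hr_inv,
        ← mul_add, mul_left_comm]
      gcongr
  rwa [midpointDefect_smul hr_inv, Real.inv_rpow hr.le, ← div_eq_inv_mul,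
    le_div_iff₀ (by positivity)] at hscaled

lemma exists_norm_sub_rpow_le_add_midpointDefect [StrictConvexSpace ℝ E] [ProperSpace E]
    (hq : 1 < q) {η : ℝ} (hη : 0 < η) :
    ∃ C : ℝ, 0 < C ∧ ∀ a b : E,
      ‖a - b‖ ^ q ≤ η * (‖a‖ ^ q + ‖b‖ ^ q) + C * midpointDefect q a b := by
  obtain ⟨d, hd, hle⟩ := exists_mul_norm_rpow_le_midpointDefect (E := E) hq hη
  refine ⟨2 ^ q / d, by positivity, fun a b => ?_⟩
  rcases le_total (‖a - b‖ ^ q) (η * (‖a‖ ^ q + ‖b‖ ^ q)) with hnear | hfar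
  · have := midpointDefect_nonneg hq a b
    exact le_add_of_le_of_nonneg hnear (by positivity)
  · refine le_add_of_nonneg_of_le (by positivity) ?_
    have hsub : ‖a - b‖ ≤ 2 * ‖(a, b)‖ :=
      (norm_sub_le a b).trans (by linarith [norm_fst_le (a, b), norm_snd_le (a, b)])
    calc ‖a - b‖ ^ q ≤ (2 * ‖(a, b)‖) ^ q :=
          Real.rpow_le_rpow (norm_nonneg _) hsub (by linarith)
      _ = 2 ^ q / d * (d * ‖(a, b)‖ ^ q) := by
          rw [Real.mul_rpow zero_le_two (norm_nonneg _)]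
          field_simp
      _ ≤ 2 ^ q / d * midpointDefect q a b := by
          gcongr
          exact hle a b hfar

lemma uniformConvexSpace_of_forall_norm_sub_rpow_le (hq : 0 < q)
    (h : ∀ η : ℝ, 0 < η → ∃ C : ℝ, 0 < C ∧ ∀ a b : E,
      ‖a - b‖ ^ q ≤ η * (‖a‖ ^ q + ‖b‖ ^ q) + C * midpointDefect q a b) :
    UniformConvexSpace E where
  uniform_convex := by
    intro ε hε
    obtain ⟨C, hC, hle⟩ := h (ε ^ q / 4) (by positivity)
    set θ := max (1 - ε ^ q / (2 * C)) 0
    have hθ0 : 0 ≤ θ := le_max_right _ _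
    have hθ1 : θ < 1 := max_lt (sub_lt_self _ (by positivity)) one_pos
    refine ⟨2 - 2 * θ ^ q⁻¹, ?_, fun a ha b hb hab => ?_⟩
    · linarith [Real.rpow_lt_one hθ0 hθ1 (inv_pos.mpr hq)]
    have hmid : ‖(1 / 2 : ℝ) • (a + b)‖ ^ q ≤ θ := by
      have hpow : ε ^ q ≤ ‖a - b‖ ^ q := by gcongr
      have hab_le := hle a b
      rw [midpointDefect, ha, hb, Real.one_rpow] at hab_le
      have hdefect : ε ^ q / (2 * C) ≤ 1 - ‖(1 / 2 : ℝ) • (a + b)‖ ^ q := by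
        rw [div_le_iff₀ (by positivity)]
        linarith
      exact le_max_of_le_left (by linarith)
    have hroot := (Real.le_rpow_inv_iff_of_pos (norm_nonneg _) hθ0 hq).mpr hmid
    rw [norm_smul_of_nonneg one_half_pos.le] at hroot
    linarith

variable {α : Type*} [MeasurableSpace α] {μ : Measure α} {p : ℝ≥0∞} [Fact (1 ≤ p)]

lemma norm_rpow_eq_integral_norm_rpow {F : Type*} [NormedAddCommGroup F] (hp : p ≠ ⊤)
    (f : Lp F p μ) : ‖f‖ ^ p.toReal = ∫ x, ‖f x‖ ^ p.toReal ∂μ := by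
  have hp0 : p ≠ 0 := (zero_lt_one.trans_le Fact.out).ne'
  rw [Lp.norm_def, toReal_eLpNorm (Lp.aestronglyMeasurable f),
    lpNorm_eq_integral_norm_rpow_toReal hp0 hp (Lp.aestronglyMeasurable f),
    Real.rpow_inv_rpow (integral_nonneg fun x => by positivity) (ENNReal.toReal_pos hp0 hp).ne']

lemma norm_sub_rpow_le_add_midpointDefect_Lp (hp : p ≠ ⊤) {η C : ℝ}
    (h : ∀ a b : E, ‖a - b‖ ^ p.toReal ≤
      η * (‖a‖ ^ p.toReal + ‖b‖ ^ p.toReal) + C * midpointDefect p.toReal a b)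
    (f g : Lp E p μ) :
    ‖f - g‖ ^ p.toReal ≤
      η * (‖f‖ ^ p.toReal + ‖g‖ ^ p.toReal) + C * midpointDefect p.toReal f g := by
  have hp0 : p ≠ 0 := (zero_lt_one.trans_le Fact.out).ne'
  have hint (u : Lp E p μ) : Integrable (fun x => ‖u x‖ ^ p.toReal) μ :=
    (Lp.memLp u).integrable_norm_rpow hp0 hp
  have hsum := (hint f).add (hint g)
  have hdefect := (hsum.div_const 2).sub (hint ((1 / 2 : ℝ) • (f + g)))
  have hbound := (hsum.const_mul η).add (hdefect.const_mul C)
  calc ‖f - g‖ ^ p.toReal = ∫ x, ‖(f - g) x‖ ^ p.toReal ∂μ :=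
        norm_rpow_eq_integral_norm_rpow hp _
    _ ≤ _ := integral_mono_ae (hint _) hbound ?_
    _ = η * (‖f‖ ^ p.toReal + ‖g‖ ^ p.toReal) + C * midpointDefect p.toReal f g := ?_
  · filter_upwards [Lp.coeFn_sub f g, Lp.coeFn_smul (1 / 2 : ℝ) (f + g), Lp.coeFn_add f g]
      with x hsub hsmul hadd
    simpa only [midpointDefect, hsub, hsmul, hadd, Pi.add_apply, Pi.sub_apply, Pi.smul_apply]
      using h (f x) (g x)
  · simp only [midpointDefect, norm_rpow_eq_integral_norm_rpow hp]
    rw [integral_add' (hsum.const_mul η) (hdefect.const_mul C), integral_const_mul,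
      integral_const_mul, integral_sub' (hsum.div_const 2) (hint _), integral_div,
      integral_add' (hint f) (hint g)]

theorem uniformConvexSpace_Lp [StrictConvexSpace ℝ E] [ProperSpace E] (hp_one : 1 < p)
    (hp : p ≠ ⊤) : UniformConvexSpace (Lp E p μ) := by
  have hq : 1 < p.toReal := by
    simpa using (ENNReal.toReal_lt_toReal ENNReal.one_ne_top hp).mpr hp_one
  refine uniformConvexSpace_of_forall_norm_sub_rpow_le (zero_lt_one.trans hq) fun η hη => ?_
  obtain ⟨C, hC, hle⟩ := exists_norm_sub_rpow_le_add_midpointDefect (E := E) hq hη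
  exact ⟨C, hC, norm_sub_rpow_le_add_midpointDefect_Lp hp hle⟩

end UniformConvexity

section LeftRegular

variable {G : Type*} [Group G] [TopologicalSpace G] [IsTopologicalGroup G]
  [MeasurableSpace G] [BorelSpace G] (μ : Measure G) [μ.IsMulLeftInvariant]
  (p : ℝ≥0∞) [Fact (1 ≤ p)]

lemma coeFn_leftTranslation (t : G) (f : Lp ℂ p μ) :
    leftTranslation μ p t f =ᵐ[μ] fun s => f (t⁻¹ * s) :=
  Lp.coeFn_compMeasurePreserving f (measurePreserving_mul_left μ t⁻¹)

/-- The left regular representation `t ↦ (f ↦ δ_t * f)` on `L^p(G)`, whose commutant is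
`CV_p(G)`. -/
def leftRegular : G →* (Lp ℂ p μ →L[ℂ] Lp ℂ p μ) where
  toFun := leftTranslation μ p
  map_one' := by
    refine ContinuousLinearMap.ext fun f => Lp.ext ?_
    filter_upwards [coeFn_leftTranslation μ p 1 f] with x hx
    rw [hx, inv_one, one_mul, one_apply_eq_self]
  map_mul' s t := by
    refine ContinuousLinearMap.ext fun f => Lp.ext ?_
    have htrans := (measurePreserving_mul_left μ s⁻¹).quasiMeasurePreserving.ae_eq_comp
      (coeFn_leftTranslation μ p t f)
    filter_upwards [coeFn_leftTranslation μ p (s * t) f,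
      coeFn_leftTranslation μ p s (leftTranslation μ p t f), htrans] with x hst hs ht
    simp only [Function.comp_apply] at ht
    rw [hst, mul_apply_eq_comp, hs, ht, mul_inv_rev, mul_assoc]

lemma norm_leftRegular_le_one (t : G) : ‖leftRegular μ p t‖ ≤ 1 :=
  LinearIsometry.norm_toContinuousLinearMap_le _

lemma continuous_leftRegular_apply [IsLocallyFiniteMeasure μ] [μ.InnerRegularCompactLTTop]
    (hp : p ≠ ⊤) (f : Lp ℂ p μ) : Continuous fun t => leftRegular μ p t f := by
  let g : C(G, C(G, G)) :=
    (ContinuousMap.mk (fun z : G × G => z.1⁻¹ * z.2) (by fun_prop)).curry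
  exact Continuous.compMeasurePreservingLp (f := fun _ : G => f) continuous_const g.continuous
    (fun t => measurePreserving_mul_left μ t⁻¹) hp

lemma convolutionOperators_eq_centralizer :
    convolutionOperators μ p = Subalgebra.centralizer ℂ (Set.range (leftRegular μ p)) := by
  ext T
  rw [Subalgebra.mem_centralizer_iff, Set.forall_mem_range]
  exact forall_congr' fun t =>
    ⟨fun h => ContinuousLinearMap.ext fun f => (h f).symm,
      fun h f => (DFunLike.congr_fun h f).symm⟩

end LeftRegular

section Commutant

variable {G : Type*} [Group G] {X : Type*} [NormedAddCommGroup X] [NormedSpace ℂ X]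
  {ρ : G →* (X →L[ℂ] X)}

lemma commute_of_mem_centralizer_range {S : X →L[ℂ] X}
    (hS : S ∈ Subalgebra.centralizer ℂ (Set.range ρ)) (t : G) : Commute S (ρ t) :=
  (Subalgebra.mem_centralizer_iff ℂ |>.mp hS (ρ t) ⟨t, rfl⟩).symm

variable [CompleteSpace X]

theorem isReflexiveOpSpace_centralizer_range (hρ : ∀ t, ‖ρ t‖ ≤ 1) :
    IsReflexiveOpSpace
      (Subalgebra.toSubmodule (Subalgebra.centralizer ℂ (Set.range ρ))) := by
  intro T hT
  refine (Subalgebra.mem_centralizer_iff ℂ).mpr (Set.forall_mem_range.mpr fun t => ?_)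
  have hconj := norm_conj_sub_le_mul_of_infDist_le hρ
    (fun S hS => commute_of_mem_centralizer_range hS) le_rfl (T := T) (fun x => by
      rw [zero_mul, (Metric.mem_closure_iff_infDist_zero ⟨0, zero_mem_opOrbit _ x⟩).mp (hT x)]) t
  rw [mul_zero, norm_le_zero_iff, sub_eq_zero] at hconj
  calc ρ t * T = ρ t * T * (ρ t⁻¹ * ρ t) := by rw [← map_mul, inv_mul_cancel, map_one, mul_one]
    _ = T * ρ t := by rw [← mul_assoc, hconj]

theorem mem_hyperreflexivityBounds_centralizer_range [TopologicalSpace G] [IsTopologicalGroup G]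
    (hρ : ∀ t, ‖ρ t‖ ≤ 1) (hG : IsAmenableGroup G) (hcont : ∀ x, Continuous fun t => ρ t x)
    (hX : Function.Surjective (NormedSpace.inclusionInDoubleDual ℂ X)) :
    288 * Real.pi * (1 + √2) ∈ hyperreflexivityBounds
      (Subalgebra.toSubmodule (Subalgebra.centralizer ℂ (Set.range ρ))) := by
  refine ⟨by positivity, fun T => ?_⟩
  set 𝒮 := Subalgebra.toSubmodule (Subalgebra.centralizer ℂ (Set.range ρ))
  obtain ⟨S, hS, hTS⟩ := exists_commute_norm_sub_le hX hG hρ hcont T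
    (norm_conj_sub_le_mul_of_infDist_le (𝒮 := 𝒮) hρ
      (fun S hS => commute_of_mem_centralizer_range hS) (reflexiveDist_nonneg 𝒮 T)
      (infDist_opOrbit_le 𝒮 T))
  have hmem : S ∈ Subalgebra.centralizer ℂ (Set.range ρ) :=
    (Subalgebra.mem_centralizer_iff ℂ).mpr (Set.forall_mem_range.mpr fun t => (hS t).symm)
  exact (Metric.infDist_le_dist_of_mem hmem).trans ((dist_eq_norm T S).trans_le hTS)

theorem mainTheorem5_general [TopologicalSpace G] [IsTopologicalGroup G] (hρ : ∀ t, ‖ρ t‖ ≤ 1) :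
    IsReflexiveOpSpace (Subalgebra.toSubmodule (Subalgebra.centralizer ℂ (Set.range ρ))) ∧
    (IsAmenableGroup G → (∀ x, Continuous fun t => ρ t x) →
      Function.Surjective (NormedSpace.inclusionInDoubleDual ℂ X) →
      IsHyperreflexive (Subalgebra.toSubmodule (Subalgebra.centralizer ℂ (Set.range ρ))) ∧
      hyperreflexivityConst (Subalgebra.toSubmodule (Subalgebra.centralizer ℂ (Set.range ρ)))
        ≤ 288 * Real.pi * (1 + √2)) := by
  refine ⟨isReflexiveOpSpace_centralizer_range hρ, fun hG hcont hX => ?_⟩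
  have hbound := mem_hyperreflexivityBounds_centralizer_range hρ hG hcont hX
  exact ⟨⟨_, hbound⟩, csInf_le ⟨0, fun C hC => hC.1⟩ hbound⟩

end Commutant

end

theorem mainTheorem5 {G : Type*} [Group G] [TopologicalSpace G] [IsTopologicalGroup G]
    [LocallyCompactSpace G] [MeasurableSpace G] [BorelSpace G]
    (μ : Measure G) [μ.IsHaarMeasure] [μ.Regular]
    (p : ℝ≥0∞) [Fact (1 ≤ p)] (hp_one : 1 < p) (hp_top : p < ⊤) :
    IsReflexiveOpSpace (Subalgebra.toSubmodule (convolutionOperators μ p)) ∧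
    (IsAmenableGroup G →
      IsHyperreflexive (Subalgebra.toSubmodule (convolutionOperators μ p)) ∧
      hyperreflexivityConst (Subalgebra.toSubmodule (convolutionOperators μ p))
        ≤ 288 * Real.pi * (1 + √2)) := by
  rw [convolutionOperators_eq_centralizer]
  have := uniformConvexSpace_Lp (E := ℂ) (μ := μ) hp_one hp_top.ne
  obtain ⟨hreflexive, hhyper⟩ := mainTheorem5_general (norm_leftRegular_le_one μ p)
  exact ⟨hreflexive, fun hG => hhyper hG (continuous_leftRegular_apply μ p hp_top.ne)
    inclusionInDoubleDual_surjective⟩
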